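/- An Orlicz function is a convex, increasing (i.e. nondecreasing), non-constant function $\varphi:[0,\infty)\to[0,\infty)$ with $\varphi(0)=0$; its conjugate is $\varphi^*(s)=\sup\{st-\varphi(t):t\ge 0\}$, $s\ge 0$. It satisfies the $\Delta_2$-condition if there are $C,t_0>0$ with $\varphi(2t)\le C\varphi(t)$ for all $t>t_0$. The Orlicz space $L^\varphi=L^\varphi[0,1]$ is the Banach lattice of (a.e. classes of) measurable functions $f$ on $[0,1]$ whose Luxemburg norm $\|f\|_\varphi=\inf\{\lambda>0:\int_0^1\varphi(|f|/\lambda)\,dt\le 1\}$ is finite, with the a.e. order, and its heart $H^\varphi$ is the subspace of those $f$ with $\int_0^1\varphi(|f|/\lambda)\,dt<\infty$ for all $\lambda>0$. We say that $\varphi$ has property $(dH)$ if every weakly null disjoint sequence in $H^\varphi$ has a subsequence whose Cesàro sequence is order bounded in $L^\varphi$. Let $X$ be a Banach lattice with norm dual $X^*$. A net $(f_\alpha)$ in $X$ order converges to $f$ if there is a net $h_\gamma\downarrow 0$ in $X$ such that for each $\gamma$ one has $|f_\alpha-f|\le h_\gamma$ for all sufficiently large $\alpha$; it $uo$-converges to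 $f$ if $|f_\alpha-f|\wedge h$ order converges to $0$ for every $h\ge 0$ in $X$. Let $X_n^\sim$ (resp. $X_{uo}^\sim$) be the set of all $g\in X^*$ such that $g(f_\alpha)\to0$ for every net $(f_\alpha)$ that order converges to $0$ (resp. for every norm bounded net that $uo$-converges to $0$). For an ideal $I$ of $X^*$ let $\sigma_I=\sigma(X,I)$, and let $|\sigma_I|$ be the topology generated by the seminorms $x\mapsto |g|(|x|)$, $g\in I$. Write $w,|w|$ for $\sigma_I,|\sigma_I|$ with $I=X^*$; $\sigma_n,|\sigma_n|$ with $I=X_n^\sim$; and $\sigma_{uo},|\sigma_{uo}|$ with $I=X_{uo}^\sim$. The Cesàro sequence of $(f_n)$ is $\big(\frac1m\sum_{n=1}^m f_n\big)_m$. The space $X$ has $doBSP$ if every norm bounded disjoint sequence in $X$ has a subsequence whose Cesàro sequence order converges in $X$, and it has $\tau$-$doBSP$ (for $\tau$ one of the above topologies) if this holds for every norm bounded disjoint sequence that converges to $0$ in $\tau$. **Theorem 5.1.** Let $\varphi$ be an Orlicz function whose conjugate $\varphi^*$ is also an Orlicz function (in particular, finite-valued). (1) The following are equivalent: $L^\varphi$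 has $doBSP$; $L^\varphi$ has $\sigma_{uo}$-$doBSP$; $L^\varphi$ has $|\sigma_{uo}|$-$doBSP$; $\varphi^*$ satisfies the $\Delta_2$-condition. (2) The following are equivalent: $L^\varphi$ has $w$-$doBSP$; $L^\varphi$ has $|w|$-$doBSP$; $L^\varphi$ has $\sigma_n$-$doBSP$; $L^\varphi$ has $|\sigma_n|$-$doBSP$; $\varphi$ has property $(dH)$. -/

import Mathlib

open Filter Topology MeasureTheory Set

noncomputable section

/-! ### Order structure of a normed lattice -/

section OrderBanachSaks

universe u

variable {X : Type u} [NormedAddCommGroup X] [Lattice X] [NormedSpace ℝ X]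

/-- Order convergence of the family `f` to `x` along the filter `l` (for a net, `l = atTop`):
there is a downward directed set `D` with infimum `0` (the range of a net decreasing to `0`)
such that each `d ∈ D` eventually dominates `|f a - x|`. -/
def OrderTendsto {ι : Type*} (f : ι → X) (l : Filter ι) (x : X) : Prop :=
  ∃ D : Set X, D.Nonempty ∧ DirectedOn (· ≥ ·) D ∧ IsGLB D 0 ∧
    ∀ d ∈ D, ∀ᶠ a in l, |f a - x| ≤ d

/-- Unbounded order convergence: `|f a - x| ∧ h` order converges to `0` for all `h ≥ 0`. -/
def UOTendsto {ι : Type*} (f : ι → X) (l : Filter ι) (x : X) : Prop :=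
  ∀ h : X, 0 ≤ h → OrderTendsto (fun a => |f a - x| ⊓ h) l 0

/-- The set `E` is order bounded in `X`. -/
def OrderBdd (E : Set X) : Prop :=
  ∃ h : X, 0 ≤ h ∧ ∀ x ∈ E, |x| ≤ h

/-- A pairwise disjoint sequence. -/
def DisjointSeq (f : ℕ → X) : Prop :=
  ∀ i j, i ≠ j → |f i| ⊓ |f j| = 0

/-- A norm bounded sequence. -/
def NormBddSeq (f : ℕ → X) : Prop :=
  ∃ M : ℝ, ∀ n, ‖f n‖ ≤ M

/-- The Cesàro sequence; its term of index `m` is the average of the first `m + 1` terms. -/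
def cesaroSeq (f : ℕ → X) (m : ℕ) : X :=
  ((m : ℝ) + 1)⁻¹ • ∑ n ∈ Finset.range (m + 1), f n

variable (X) in
/-- The order continuous dual `X_n^∼`: the functionals `g` with `g (f_α) → 0` for every net
`f_α` that order converges to `0`. -/
def orderContDual : Set (StrongDual ℝ X) :=
  {g | ∀ (ι : Type u) [Preorder ι] [IsDirectedOrder ι] [Nonempty ι] (f : ι → X),
    OrderTendsto f atTop 0 → Tendsto (fun a => g (f a)) atTop (𝓝 0)}

variable (X) in
/-- The uo-dual `X_uo^∼`: the functionals `g` with `g (f_α) → 0` for every norm bounded net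
`f_α` that uo-converges to `0`. -/
def uoDual : Set (StrongDual ℝ X) :=
  {g | ∀ (ι : Type u) [Preorder ι] [IsDirectedOrder ι] [Nonempty ι] (f : ι → X),
    (∃ M : ℝ, ∀ a, ‖f a‖ ≤ M) → UOTendsto f atTop 0 →
      Tendsto (fun a => g (f a)) atTop (𝓝 0)}

/-- The value `|g| x`, for `x ≥ 0`, of the modulus `|g| = g ∨ (-g)` of `g` in the dual Banach
lattice `X^*`, by the Riesz–Kantorovich formula. -/
def dualAbs (g : StrongDual ℝ X) (x : X) : ℝ :=
  sSup {r : ℝ | ∃ y : X, |y| ≤ x ∧ r = |g y|}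

/-- `f` converges to `0` in `σ(X, I)`. -/
def SigmaNull (I : Set (StrongDual ℝ X)) (f : ℕ → X) : Prop :=
  ∀ g ∈ I, Tendsto (fun n => g (f n)) atTop (𝓝 0)

/-- `f` converges to `0` in the absolute weak topology `|σ|(X, I)`, which is generated by the
seminorms `x ↦ |g| |x|`, `g ∈ I`. -/
def AbsSigmaNull (I : Set (StrongDual ℝ X)) (f : ℕ → X) : Prop :=
  ∀ g ∈ I, Tendsto (fun n => dualAbs g |f n|) atTop (𝓝 0)

variable (X) in
/-- The disjoint order Banach–Saks property (`doBSP`). -/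
def DoBSP : Prop :=
  ∀ f : ℕ → X, NormBddSeq f → DisjointSeq f →
    ∃ k : ℕ → ℕ, StrictMono k ∧ ∃ x : X, OrderTendsto (cesaroSeq (f ∘ k)) atTop x

/-- The `σ(X, I)`-disjoint order Banach–Saks property. -/
def SigmaDoBSP (I : Set (StrongDual ℝ X)) : Prop :=
  ∀ f : ℕ → X, SigmaNull I f → NormBddSeq f → DisjointSeq f →
    ∃ k : ℕ → ℕ, StrictMono k ∧ ∃ x : X, OrderTendsto (cesaroSeq (f ∘ k)) atTop x

/-- The `|σ|(X, I)`-disjoint order Banach–Saks property. -/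
def AbsSigmaDoBSP (I : Set (StrongDual ℝ X)) : Prop :=
  ∀ f : ℕ → X, AbsSigmaNull I f → NormBddSeq f → DisjointSeq f →
    ∃ k : ℕ → ℕ, StrictMono k ∧ ∃ x : X, OrderTendsto (cesaroSeq (f ∘ k)) atTop x

end OrderBanachSaks

/-! ### Orlicz functions -/

/-- An Orlicz function `φ : [0, ∞) → [0, ∞)`: convex, increasing (in the wide sense),
non-constant, with `φ 0 = 0`. The values at negative arguments play no role. -/
structure OrliczFunction where
  toFun : ℝ → ℝ
  convexOn' : ConvexOn ℝ (Ici 0) toFun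
  monotoneOn' : MonotoneOn toFun (Ici 0)
  map_zero' : toFun 0 = 0
  nonconst' : ∃ t, 0 ≤ t ∧ toFun t ≠ 0

namespace OrliczFunction

instance : CoeFun OrliczFunction (fun _ => ℝ → ℝ) := ⟨toFun⟩

/-- `ψ` is the conjugate `φ^*` of `φ`, i.e. `ψ s = sup {s t - φ t : t ≥ 0}` for all `s ≥ 0`;
in particular each of these suprema is finite. -/
def IsConjugate (φ ψ : OrliczFunction) : Prop :=
  ∀ s : ℝ, 0 ≤ s → IsLUB {r : ℝ | ∃ t : ℝ, 0 ≤ t ∧ r = s * t - φ t} (ψ s)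

/-- The `Δ₂`-condition (at infinity). -/
def DeltaTwo (φ : OrliczFunction) : Prop :=
  ∃ C > 0, ∃ t₀ > 0, ∀ t > t₀, φ (2 * t) ≤ C * φ t

variable {φ : OrliczFunction}

lemma nonneg {t : ℝ} (ht : 0 ≤ t) : 0 ≤ φ t := by
  have := φ.monotoneOn' (mem_Ici.2 le_rfl) (mem_Ici.2 ht) ht
  rwa [φ.map_zero'] at this

lemma mono {s t : ℝ} (hs : 0 ≤ s) (hst : s ≤ t) : φ s ≤ φ t :=
  φ.monotoneOn' (mem_Ici.2 hs) (mem_Ici.2 (hs.trans hst)) hst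

lemma convex_le {x y a b : ℝ} (hx : 0 ≤ x) (hy : 0 ≤ y) (ha : 0 ≤ a) (hb : 0 ≤ b)
    (hab : a + b = 1) : φ (a * x + b * y) ≤ a * φ x + b * φ y :=
  φ.convexOn'.2 (mem_Ici.2 hx) (mem_Ici.2 hy) ha hb hab

end OrliczFunction

/-! ### Orlicz spaces -/

section OrliczSpace

variable {Ω : Type*} [MeasurableSpace Ω]

/-- The integral `∫ φ(|f| / c) dμ`, with values in `[0, ∞]`. -/
def orliczIntegral (φ : OrliczFunction) (μ : Measure Ω) (f : Ω →ₘ[μ] ℝ) (c : ℝ) : ENNReal :=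
  ∫⁻ ω, ENNReal.ofReal (φ (|f ω| / c)) ∂μ

variable {φ : OrliczFunction} {μ : Measure Ω}

lemma orliczIntegral_mono {f g : Ω →ₘ[μ] ℝ} (hfg : |f| ≤ |g|) {c d : ℝ} (hc : 0 < c)
    (hcd : c ≤ d) : orliczIntegral φ μ f d ≤ orliczIntegral φ μ g c := by
  refine lintegral_mono_ae ?_
  filter_upwards [AEEqFun.coeFn_le.2 hfg, AEEqFun.coeFn_abs f, AEEqFun.coeFn_abs g]
    with ω h hf hg
  rw [hf, hg] at h
  have hd := hc.trans_le hcd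
  exact ENNReal.ofReal_le_ofReal (φ.mono (by positivity) (by gcongr))

lemma orlicz_measurable (f : Ω →ₘ[μ] ℝ) {c : ℝ} (hc : 0 < c) :
    Measurable fun ω => ENNReal.ofReal (φ (|f ω| / c)) := by
  have hm : Monotone fun x : ℝ => φ (max x 0) := fun x y h =>
    φ.mono (le_max_right _ _) (max_le_max h le_rfl)
  have he : (fun ω => ENNReal.ofReal (φ (|f ω| / c)))
      = fun ω => ENNReal.ofReal ((fun x : ℝ => φ (max x 0)) (|f ω| / c)) := by
    funext ω
    have h0 : 0 ≤ |f ω| / c := by positivity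
    simp only [max_eq_left h0]
  rw [he]
  exact (hm.measurable.comp ((measurable_norm.comp f.measurable).div_const c)).ennreal_ofReal

lemma orliczIntegral_add_le (f g : Ω →ₘ[μ] ℝ) {c d : ℝ} (hc : 0 < c) (hd : 0 < d) :
    orliczIntegral φ μ (f + g) (c + d) ≤ ENNReal.ofReal (c / (c + d)) * orliczIntegral φ μ f c +
      ENNReal.ofReal (d / (c + d)) * orliczIntegral φ μ g d := by
  have hcd : 0 < c + d := by positivity
  unfold orliczIntegral
  rw [← lintegral_const_mul _ (orlicz_measurable f hc),
    ← lintegral_const_mul _ (orlicz_measurable g hd),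
    ← lintegral_add_left ((orlicz_measurable f hc).const_mul _)]
  refine lintegral_mono_ae ?_
  filter_upwards [AEEqFun.coeFn_add f g] with ω h
  rw [h, Pi.add_apply, ← ENNReal.ofReal_mul (by positivity), ← ENNReal.ofReal_mul (by positivity),
    ← ENNReal.ofReal_add (mul_nonneg (by positivity) (φ.nonneg (by positivity)))
      (mul_nonneg (by positivity) (φ.nonneg (by positivity)))]
  refine ENNReal.ofReal_le_ofReal ?_
  have hconv := OrliczFunction.convex_le (φ := φ) (x := |f ω| / c) (y := |g ω| / d)
    (a := c / (c + d)) (b := d / (c + d)) (by positivity) (by positivity) (by positivity)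
    (by positivity) (by field_simp)
  refine le_trans (φ.mono (by positivity) ?_) hconv
  have : c / (c + d) * (|f ω| / c) + d / (c + d) * (|g ω| / d) = (|f ω| + |g ω|) / (c + d) := by
    field_simp
  rw [this]
  gcongr
  exact abs_add_le _ _

lemma orliczIntegral_smul (a : ℝ) (f : Ω →ₘ[μ] ℝ) (ha : a ≠ 0) (c : ℝ) :
    orliczIntegral φ μ (a • f) (|a| * c) = orliczIntegral φ μ f c := by
  refine lintegral_congr_ae ?_
  filter_upwards [AEEqFun.coeFn_smul a f] with ω h
  rw [h, Pi.smul_apply, smul_eq_mul, abs_mul, mul_div_mul_left _ _ (abs_ne_zero.2 ha)]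

lemma orliczIntegral_zero (c : ℝ) : orliczIntegral φ μ 0 c = 0 := by
  have : orliczIntegral φ μ 0 c = ∫⁻ _, 0 ∂μ := by
    refine lintegral_congr_ae ?_
    filter_upwards [AEEqFun.coeFn_zero (α := Ω) (β := ℝ) (μ := μ)] with ω h
    rw [h]
    simp [φ.map_zero']
  simpa using this

/-- The positive numbers `c` with `∫ φ(|f| / c) dμ ≤ 1`. -/
def luxemburgSet (φ : OrliczFunction) (μ : Measure Ω) (f : Ω →ₘ[μ] ℝ) : Set ℝ :=
  {c : ℝ | 0 < c ∧ orliczIntegral φ μ f c ≤ 1}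

lemma luxemburgSet_bddBelow (f : Ω →ₘ[μ] ℝ) : BddBelow (luxemburgSet φ μ f) :=
  ⟨0, fun _ hc => hc.1.le⟩

lemma luxemburgSet_add {f g : Ω →ₘ[μ] ℝ} {c d : ℝ} (hc : c ∈ luxemburgSet φ μ f)
    (hd : d ∈ luxemburgSet φ μ g) : c + d ∈ luxemburgSet φ μ (f + g) := by
  obtain ⟨hc0, hc1⟩ := hc
  obtain ⟨hd0, hd1⟩ := hd
  refine ⟨by positivity, (orliczIntegral_add_le f g hc0 hd0).trans ?_⟩
  calc _ ≤ ENNReal.ofReal (c / (c + d)) * 1 + ENNReal.ofReal (d / (c + d)) * 1 := by gcongr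
    _ = 1 := by
      rw [mul_one, mul_one, ← ENNReal.ofReal_add (by positivity) (by positivity), ← add_div,
        div_self (by positivity), ENNReal.ofReal_one]

lemma luxemburgSet_smul {f : Ω →ₘ[μ] ℝ} {a c : ℝ} (ha : a ≠ 0) (hc : c ∈ luxemburgSet φ μ f) :
    |a| * c ∈ luxemburgSet φ μ (a • f) := by
  have := hc.1
  have := abs_pos.2 ha
  exact ⟨by positivity, (orliczIntegral_smul a f ha c).trans_le hc.2⟩

lemma luxemburgSet_solid {f g : Ω →ₘ[μ] ℝ} (h : |f| ≤ |g|) :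
    luxemburgSet φ μ g ⊆ luxemburgSet φ μ f :=
  fun _ hc => ⟨hc.1, (orliczIntegral_mono h hc.1 le_rfl).trans hc.2⟩

variable (φ μ) in
/-- The Orlicz space `L^φ(μ)`: the (classes of) measurable functions whose Luxemburg norm
`inf {c > 0 : ∫ φ(|f| / c) dμ ≤ 1}` is finite. -/
def OrliczSpace : Submodule ℝ (Ω →ₘ[μ] ℝ) where
  carrier := {f | (luxemburgSet φ μ f).Nonempty}
  zero_mem' := ⟨1, one_pos, by simp [orliczIntegral_zero]⟩
  add_mem' := by
    rintro f g ⟨c, hc⟩ ⟨d, hd⟩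
    exact ⟨c + d, luxemburgSet_add hc hd⟩
  smul_mem' := by
    rintro a f ⟨c, hc⟩
    by_cases ha : a = 0
    · subst ha
      rw [zero_smul]
      exact ⟨1, one_pos, by simp [orliczIntegral_zero]⟩
    · exact ⟨|a| * c, luxemburgSet_smul ha hc⟩

namespace OrliczSpace

/-- The Luxemburg norm. -/
instance : Norm (OrliczSpace φ μ) := ⟨fun f => sInf (luxemburgSet φ μ f.1)⟩

lemma norm_def (f : OrliczSpace φ μ) : ‖f‖ = sInf (luxemburgSet φ μ f.1) := rfl

lemma norm_nonneg' (f : OrliczSpace φ μ) : 0 ≤ ‖f‖ :=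
  Real.sInf_nonneg fun _ hc => hc.1.le

lemma norm_smul_le' (a : ℝ) (f : OrliczSpace φ μ) (ha : a ≠ 0) : ‖a • f‖ ≤ |a| * ‖f‖ := by
  have ha' := abs_pos.2 ha
  rw [← div_le_iff₀' ha', norm_def f]
  refine le_csInf f.2 fun c hc => ?_
  rw [div_le_iff₀' ha']
  exact csInf_le (luxemburgSet_bddBelow _) (luxemburgSet_smul ha hc)

lemma norm_zero' : ‖(0 : OrliczSpace φ μ)‖ = 0 := by
  refine le_antisymm (le_of_forall_pos_le_add fun ε hε => ?_) (norm_nonneg' _)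
  rw [zero_add]
  exact csInf_le (luxemburgSet_bddBelow _)
    ⟨hε, by rw [show ((0 : OrliczSpace φ μ) : Ω →ₘ[μ] ℝ) = 0 from rfl, orliczIntegral_zero]; simp⟩

lemma eq_zero_of_norm_eq_zero' (f : OrliczSpace φ μ) (hf : ‖f‖ = 0) : f = 0 := by
  have key : ∀ c : ℝ, 0 < c → orliczIntegral φ μ f.1 c ≤ 1 := by
    intro c hc
    obtain ⟨d, hd, hdc⟩ := exists_lt_of_csInf_lt f.2 (show sInf (luxemburgSet φ μ f.1) < c by
      rw [← norm_def, hf]; exact hc)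
    exact (orliczIntegral_mono le_rfl hd.1 hdc.le).trans hd.2
  obtain ⟨t, ht, hφt⟩ := φ.nonconst'
  have hφt' : 0 < φ t := lt_of_le_of_ne (φ.nonneg ht) (Ne.symm hφt)
  have ht' : 0 < t := lt_of_le_of_ne ht (by rintro rfl; exact hφt φ.map_zero')
  -- convexity gives `n φ(t) ≤ φ(n t)`
  have hgrow : ∀ n : ℕ, (n + 1 : ℝ) * φ t ≤ φ ((n + 1 : ℝ) * t) := by
    intro n
    have hn : (0 : ℝ) < n + 1 := by positivity
    have h := OrliczFunction.convex_le (φ := φ) (x := (n + 1 : ℝ) * t) (y := 0)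
      (a := 1 / (n + 1 : ℝ)) (b := 1 - 1 / (n + 1 : ℝ)) (by positivity) le_rfl (by positivity)
      (by rw [sub_nonneg, div_le_one hn]; linarith [n.cast_nonneg (α := ℝ)]) (by ring)
    simp only [mul_zero, add_zero, φ.map_zero'] at h
    have e : 1 / (n + 1 : ℝ) * ((n + 1 : ℝ) * t) = t := by field_simp
    rw [e, one_div, inv_mul_eq_div, le_div_iff₀ hn] at h
    linarith
  -- Markov's inequality
  have hnull : ∀ ε : ℝ, 0 < ε → μ {ω | ε ≤ |f.1 ω|} = 0 := by
    intro ε hε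
    by_contra hne
    have hle : ∀ n : ℕ, ENNReal.ofReal ((n + 1 : ℝ) * φ t) * μ {ω | ε ≤ |f.1 ω|} ≤ 1 := by
      intro n
      have hn : (0 : ℝ) < n + 1 := by positivity
      have hc : 0 < ε / ((n + 1 : ℝ) * t) := by positivity
      refine le_trans ?_ (key _ hc)
      refine le_trans ?_ (mul_meas_ge_le_lintegral (orlicz_measurable f.1 hc)
        (ENNReal.ofReal ((n + 1 : ℝ) * φ t)))
      refine mul_le_mul' le_rfl (measure_mono fun ω hω => ?_)
      change ε ≤ |f.1 ω| at hω
      refine ENNReal.ofReal_le_ofReal ((hgrow n).trans (φ.mono (by positivity) ?_))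
      rw [le_div_iff₀ hc]
      calc (n + 1 : ℝ) * t * (ε / ((n + 1 : ℝ) * t)) = ε := by field_simp
        _ ≤ _ := hω
    have htop : Tendsto (fun n : ℕ => ENNReal.ofReal ((n + 1 : ℝ) * φ t)) atTop (𝓝 ⊤) := by
      refine ENNReal.tendsto_ofReal_atTop.comp ?_
      refine Tendsto.atTop_mul_const hφt' ?_
      exact tendsto_atTop_add_const_right _ _ tendsto_natCast_atTop_atTop
    have h2 := ENNReal.Tendsto.mul_const (b := μ {ω | ε ≤ |f.1 ω|}) htop (Or.inl ENNReal.top_ne_zero)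
    rw [ENNReal.top_mul hne] at h2
    exact absurd (le_of_tendsto' h2 hle) (by simp)
  refine Subtype.ext (AEEqFun.ext ?_)
  have hall : ∀ᵐ ω ∂μ, ∀ n : ℕ, |f.1 ω| < 1 / (n + 1 : ℝ) := by
    rw [ae_all_iff]
    intro n
    have := hnull (1 / (n + 1 : ℝ)) (by positivity)
    rw [ae_iff]
    simpa only [not_lt] using this
  filter_upwards [hall, AEEqFun.coeFn_zero (α := Ω) (β := ℝ) (μ := μ)] with ω h h0
  rw [show ((0 : OrliczSpace φ μ) : Ω →ₘ[μ] ℝ) = 0 from rfl, h0]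
  refine abs_eq_zero.1 (le_antisymm ?_ (abs_nonneg _))
  exact ge_of_tendsto' tendsto_one_div_add_atTop_nhds_zero_nat fun n => (h n).le

lemma normedCore : NormedSpace.Core ℝ (OrliczSpace φ μ) where
  norm_nonneg := norm_nonneg'
  norm_smul a f := by
    rw [Real.norm_eq_abs]
    by_cases ha : a = 0
    · subst ha
      rw [zero_smul, norm_zero', abs_zero, zero_mul]
    · refine le_antisymm (norm_smul_le' a f ha) ?_
      have h := norm_smul_le' a⁻¹ (a • f) (inv_ne_zero ha)
      rwa [inv_smul_smul₀ ha, abs_inv, ← div_eq_inv_mul, le_div_iff₀' (abs_pos.2 ha)] at h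
  norm_triangle f g := by
    refine le_of_forall_pos_le_add fun ε hε => ?_
    obtain ⟨c, hc, hc'⟩ := exists_lt_of_csInf_lt f.2
      (show sInf (luxemburgSet φ μ f.1) < ‖f‖ + ε / 2 by rw [← norm_def]; linarith)
    obtain ⟨d, hd, hd'⟩ := exists_lt_of_csInf_lt g.2
      (show sInf (luxemburgSet φ μ g.1) < ‖g‖ + ε / 2 by rw [← norm_def]; linarith)
    have : ‖f + g‖ ≤ c + d :=
      csInf_le (luxemburgSet_bddBelow _) (luxemburgSet_add hc hd)
    linarith
  norm_eq_zero_iff f := ⟨eq_zero_of_norm_eq_zero' f, by rintro rfl; exact norm_zero'⟩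

instance : NormedAddCommGroup (OrliczSpace φ μ) := NormedAddCommGroup.ofCore normedCore

instance : NormedSpace ℝ (OrliczSpace φ μ) where
  norm_smul_le a f := (normedCore.norm_smul a f).le

lemma mem_of_abs_le {f g : Ω →ₘ[μ] ℝ} (h : |f| ≤ |g|) (hg : g ∈ OrliczSpace φ μ) :
    f ∈ OrliczSpace φ μ :=
  Nonempty.mono (luxemburgSet_solid h) hg

lemma abs_mem {f : Ω →ₘ[μ] ℝ} (hf : f ∈ OrliczSpace φ μ) : |f| ∈ OrliczSpace φ μ := by
  refine mem_of_abs_le ?_ hf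
  rw [← AEEqFun.coeFn_le]
  filter_upwards [AEEqFun.coeFn_abs f, AEEqFun.coeFn_abs |f|] with ω h1 h2
  rw [h2, h1, abs_abs]

/-- The almost everywhere order; suprema and infima of two elements are pointwise. -/
instance : Lattice (OrliczSpace φ μ) :=
  Subtype.lattice
    (fun f g hf hg => by
      refine mem_of_abs_le ?_ (Submodule.add_mem _ (abs_mem hf) (abs_mem hg))
      rw [← AEEqFun.coeFn_le]
      filter_upwards [AEEqFun.coeFn_abs f, AEEqFun.coeFn_abs g, AEEqFun.coeFn_sup f g,
        AEEqFun.coeFn_abs (f ⊔ g), AEEqFun.coeFn_abs (|f| + |g|), AEEqFun.coeFn_add |f| |g|]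
        with ω h1 h2 h3 h4 h5 h6
      rw [h4, h5, h6, Pi.add_apply, h1, h2, h3, abs_of_nonneg (a := |f ω| + |g ω|) (by positivity)]
      exact abs_max_le_max_abs_abs.trans (max_le (le_add_of_nonneg_right (abs_nonneg _))
        (le_add_of_nonneg_left (abs_nonneg _))))
    (fun f g hf hg => by
      refine mem_of_abs_le ?_ (Submodule.add_mem _ (abs_mem hf) (abs_mem hg))
      rw [← AEEqFun.coeFn_le]
      filter_upwards [AEEqFun.coeFn_abs f, AEEqFun.coeFn_abs g, AEEqFun.coeFn_inf f g,
        AEEqFun.coeFn_abs (f ⊓ g), AEEqFun.coeFn_abs (|f| + |g|), AEEqFun.coeFn_add |f| |g|]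
        with ω h1 h2 h3 h4 h5 h6
      rw [h4, h5, h6, Pi.add_apply, h1, h2, h3, abs_of_nonneg (a := |f ω| + |g ω|) (by positivity)]
      exact abs_min_le_max_abs_abs.trans (max_le (le_add_of_nonneg_right (abs_nonneg _))
        (le_add_of_nonneg_left (abs_nonneg _))))

lemma coe_abs (f : OrliczSpace φ μ) : ((|f| : OrliczSpace φ μ) : Ω →ₘ[μ] ℝ) = |f.1| := rfl

instance : HasSolidNorm (OrliczSpace φ μ) where
  solid _ g h := csInf_le_csInf (luxemburgSet_bddBelow _) g.2 (luxemburgSet_solid h)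

instance : IsOrderedAddMonoid (OrliczSpace φ μ) where
  add_le_add_left f g h k := by
    have h' : f.1 ≤ g.1 := h
    change f.1 + k.1 ≤ g.1 + k.1
    rw [← AEEqFun.coeFn_le] at h' ⊢
    filter_upwards [h', AEEqFun.coeFn_add f.1 k.1, AEEqFun.coeFn_add g.1 k.1] with ω h1 h2 h3
    rw [h2, h3, Pi.add_apply, Pi.add_apply]
    exact add_le_add h1 le_rfl

end OrliczSpace

variable (φ μ) in
/-- The Orlicz heart `H^φ(μ)`: the `f ∈ L^φ(μ)` with `∫ φ(|f| / c) dμ < ∞` for all `c > 0`,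
normed as a subspace of `L^φ(μ)`. -/
def OrliczHeart : Submodule ℝ (OrliczSpace φ μ) where
  carrier := {f | ∀ c : ℝ, 0 < c → orliczIntegral φ μ f.1 c < ⊤}
  zero_mem' c _ := by
    rw [show ((0 : OrliczSpace φ μ) : Ω →ₘ[μ] ℝ) = 0 from rfl, orliczIntegral_zero]
    simp
  add_mem' := by
    intro f g hf hg c hc
    have h := orliczIntegral_add_le (φ := φ) f.1 g.1 (half_pos hc) (half_pos hc)
    rw [add_halves] at h
    refine h.trans_lt ?_
    exact ENNReal.add_lt_top.2 ⟨ENNReal.mul_lt_top ENNReal.ofReal_lt_top (hf _ (half_pos hc)),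
      ENNReal.mul_lt_top ENNReal.ofReal_lt_top (hg _ (half_pos hc))⟩
  smul_mem' := by
    intro a f hf c hc
    by_cases ha : a = 0
    · subst ha
      rw [zero_smul, show ((0 : OrliczSpace φ μ) : Ω →ₘ[μ] ℝ) = 0 from rfl, orliczIntegral_zero]
      simp
    · have ha' := abs_pos.2 ha
      have h := orliczIntegral_smul (φ := φ) a f.1 ha (c / |a|)
      rw [mul_div_cancel₀ _ ha'.ne'] at h
      change orliczIntegral φ μ (a • f.1) c < ⊤
      rw [h]
      exact hf _ (by positivity)

end OrliczSpace

/-- Lebesgue measure on `[0, 1]`. -/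
abbrev unitLebesgue : Measure ℝ := volume.restrict (Icc 0 1)

/-- Property `(dH)`: every weakly null disjoint sequence in `H^φ[0,1]` has a subsequence whose
Cesàro sequence is order bounded in `L^φ[0,1]`. -/
def OrliczFunction.PropertyDH (φ : OrliczFunction) : Prop :=
  ∀ f : ℕ → OrliczHeart φ unitLebesgue,
    (∀ g : StrongDual ℝ (OrliczHeart φ unitLebesgue),
      Tendsto (fun n => g (f n)) atTop (𝓝 0)) →
    DisjointSeq (fun n => (f n : OrliczSpace φ unitLebesgue)) →
    ∃ k : ℕ → ℕ, StrictMono k ∧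
      OrderBdd (range (cesaroSeq fun n => (f (k n) : OrliczSpace φ unitLebesgue)))

end

/-!
In an Orlicz space over a finite measure, a disjoint sequence `f` has, at almost every point, at
most one nonzero term. Hence its Cesàro means tend to `0` almost everywhere, and they converge in
order as soon as they are order bounded (`DisjointSeq.orderTendsto_cesaroSeq`). The pointwise
supremum of their moduli is `∑ |f n| / (n + 1)`, so order boundedness is a statement about the sum
of the integrals `∫ φ(|f n| / ((n + 1) c))` (`DisjointSeq.orderBdd_cesaroSeq`).

The second tool is masking: if `|y n| ≤ |f n|` for a disjoint sequence `f`, then a single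
multiplication operator maps each `f n` to `y n` (`DisjointSeq.exists_mask`). It makes absolute weak
nullity accessible through plain weak nullity.

**The `Δ₂` part.** Every norm bounded disjoint sequence is `|σ_uo|`-null, because whatever it
dominates is disjoint, hence uo-null (`OrliczSpace.absSigmaNull_uoDual`); so the three disjoint
order Banach–Saks properties coincide. The conjugate `ψ` satisfies `Δ₂` exactly when
`2 l φ(t) ≤ φ(l t)` for some `l > 1` and all large `t`. Iterating this inequality gives
`φ(t / n) ≤ C n ^ (-p) φ(t)` with `p > 1` as long as `t / n` is large, which makes the above sum
finite (`OrliczSpace.doBSP_of_deltaTwo`). If it fails, `φ` is almost linear on long intervals, and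
normalised indicators at the corresponding heights produce a harmonic series
(`OrliczSpace.deltaTwo_of_doBSP`).

**The `(dH)` part.** The implications `σ_n ⇒ w ⇒ |w|` and `σ_n ⇒ |σ_n| ⇒ |w|` are formal. From
`|w|` to `(dH)`, a weakly null disjoint sequence of the heart is norm bounded by the uniform
boundedness principle, and `|w|`-null by masking. From `(dH)` to `σ_n`, each `f n` is truncated: the
remainders have summable `φ`-integrals, and the bounded parts are weakly null in the heart. The
latter holds because every functional on the heart has a Radon–Nikodym density `w`, integration
against `w` is an order continuous functional on the whole space, and both agree on bounded
functions (`OrliczHeart.exists_orderContDual_eq`).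
-/

/-! ### Order convergence in normed lattices -/

section NormedLattice

variable {X : Type*} [NormedAddCommGroup X] [Lattice X]

section Dual

variable [NormedSpace ℝ X]

lemma abs_apply_le_dualAbs [HasSolidNorm X] (g : StrongDual ℝ X) {x y : X} (h : |y| ≤ |x|) :
    |g y| ≤ dualAbs g |x| := by
  refine le_csSup ⟨‖g‖ * ‖x‖, ?_⟩ ⟨y, h, rfl⟩
  rintro r ⟨z, hz, rfl⟩
  calc |g z| ≤ ‖g‖ * ‖z‖ := g.le_opNorm z
    _ ≤ ‖g‖ * ‖x‖ := by
      have := HasSolidNorm.solid hz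
      gcongr

lemma exists_lt_abs_apply (g : StrongDual ℝ X) (x : X) {ε : ℝ} (hε : 0 < ε) :
    ∃ y : X, |y| ≤ |x| ∧ dualAbs g |x| < |g y| + ε := by
  obtain ⟨r, ⟨y, hy, rfl⟩, hr⟩ := exists_lt_of_lt_csSup
    (s := {r : ℝ | ∃ y : X, |y| ≤ |x| ∧ r = |g y|}) (b := dualAbs g |x| - ε)
    ⟨_, x, le_rfl, rfl⟩ (by unfold dualAbs; linarith)
  exact ⟨y, hy, by linarith⟩

/-- Absolute weak convergence to `0` follows from weak convergence to `0` of every sequence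
dominated by the given one: `dualAbs g |f n|` is almost attained at some `|y n| ≤ |f n|`. -/
lemma tendsto_dualAbs_of_dominated {g : StrongDual ℝ X} {f : ℕ → X}
    (h : ∀ y : ℕ → X, (∀ n, |y n| ≤ |f n|) → Tendsto (fun n => g (y n)) atTop (𝓝 0)) :
    Tendsto (fun n => dualAbs g |f n|) atTop (𝓝 0) := by
  choose y hy hy' using fun n : ℕ =>
    exists_lt_abs_apply g (f n) (ε := 1 / ((n : ℝ) + 1)) (by positivity)
  have h1 := (h y hy).abs.add tendsto_one_div_add_atTop_nhds_zero_nat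
  rw [abs_zero, zero_add] at h1
  refine squeeze_zero (fun n => ?_) (fun n => (hy' n).le) h1
  refine Real.sSup_nonneg ?_
  rintro r ⟨z, -, rfl⟩
  exact abs_nonneg _

lemma AbsSigmaNull.sigmaNull [HasSolidNorm X] {I : Set (StrongDual ℝ X)} {f : ℕ → X}
    (h : AbsSigmaNull I f) : SigmaNull I f := fun g hg =>
  squeeze_zero_norm (fun _ => abs_apply_le_dualAbs g le_rfl) (h g hg)

end Dual

lemma OrderTendsto.of_abs_le {ι : Type*} {l : Filter ι} {f g : ι → X} (hf : OrderTendsto f l 0)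
    (h : ∀ a, |g a| ≤ |f a|) : OrderTendsto g l 0 := by
  obtain ⟨D, h1, h2, h3, h4⟩ := hf
  refine ⟨D, h1, h2, h3, fun d hd => (h4 d hd).mono fun a ha => ?_⟩
  rw [sub_zero] at ha ⊢
  exact (h a).trans ha

variable [IsOrderedAddMonoid X]

lemma OrderTendsto.orderBdd_range {c : ℕ → X} {x : X} (h : OrderTendsto c atTop x) :
    OrderBdd (range c) := by
  obtain ⟨D, ⟨d, hd⟩, -, -, hD⟩ := h
  obtain ⟨N, hN⟩ := eventually_atTop.1 (hD d hd)
  have hs : 0 ≤ ∑ i ∈ Finset.range N, |c i| := Finset.sum_nonneg fun i _ => abs_nonneg _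
  refine ⟨|d| + |x| + ∑ i ∈ Finset.range N, |c i|,
    add_nonneg (add_nonneg (abs_nonneg _) (abs_nonneg _)) hs, ?_⟩
  rintro _ ⟨m, rfl⟩
  by_cases hm : N ≤ m
  · calc |c m| = |(c m - x) + x| := by rw [sub_add_cancel]
      _ ≤ |c m - x| + |x| := abs_add_le _ _
      _ ≤ |d| + |x| := add_le_add ((hN m hm).trans (le_abs_self d)) le_rfl
      _ ≤ _ := le_add_of_nonneg_right hs
  · calc |c m| ≤ ∑ i ∈ Finset.range N, |c i| :=
        Finset.single_le_sum (f := fun i => |c i|) (fun i _ => abs_nonneg _)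
          (Finset.mem_range.2 (not_le.1 hm))
      _ ≤ _ := le_add_of_nonneg_left (add_nonneg (abs_nonneg _) (abs_nonneg _))

lemma OrderBdd.cesaroSeq_add [NormedSpace ℝ X] {u v : ℕ → X} (hu : OrderBdd (range (cesaroSeq u)))
    (hv : OrderBdd (range (cesaroSeq v))) : OrderBdd (range (cesaroSeq (u + v))) := by
  obtain ⟨a, ha, ha'⟩ := hu
  obtain ⟨b, hb, hb'⟩ := hv
  refine ⟨a + b, add_nonneg ha hb, ?_⟩
  rintro _ ⟨m, rfl⟩
  have : cesaroSeq (u + v) m = cesaroSeq u m + cesaroSeq v m := by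
    simp [cesaroSeq, Finset.sum_add_distrib]
  rw [this]
  exact (abs_add_le _ _).trans (add_le_add (ha' _ ⟨m, rfl⟩) (hb' _ ⟨m, rfl⟩))

end NormedLattice

/-! ### Pointwise description of Orlicz spaces -/

lemma OrliczFunction.map_div_le {φ : OrliczFunction} {x K : ℝ} (hx : 0 ≤ x) (hK : 1 ≤ K) :
    φ (x / K) ≤ φ x / K := by
  have h := OrliczFunction.convex_le (φ := φ) (x := x) (y := 0) (a := 1 / K) (b := 1 - 1 / K) hx
    le_rfl (by positivity) (by rw [sub_nonneg, div_le_one (by linarith)]; exact hK) (by ring)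
  simp only [mul_zero, add_zero, φ.map_zero'] at h
  rwa [one_div_mul_eq_div, one_div_mul_eq_div] at h

section Orlicz

variable {Ω : Type*} [MeasurableSpace Ω] {φ : OrliczFunction} {μ : Measure Ω}

namespace OrliczSpace

lemma le_iff_ae {f g : OrliczSpace φ μ} : f ≤ g ↔ ∀ᵐ ω ∂μ, f.1 ω ≤ g.1 ω :=
  (AEEqFun.coeFn_le (f := f.1) (g := g.1)).symm

lemma coeFn_abs (f : OrliczSpace φ μ) : ∀ᵐ ω ∂μ, (|f|).1 ω = |f.1 ω| :=
  AEEqFun.coeFn_abs f.1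

lemma abs_le_abs_iff_ae {f g : OrliczSpace φ μ} :
    |f| ≤ |g| ↔ ∀ᵐ ω ∂μ, |f.1 ω| ≤ |g.1 ω| := by
  rw [le_iff_ae]
  refine eventually_congr ?_
  filter_upwards [coeFn_abs f, coeFn_abs g] with ω h1 h2
  rw [h1, h2]

lemma abs_le_iff_ae {f g : OrliczSpace φ μ} : |f| ≤ g ↔ ∀ᵐ ω ∂μ, |f.1 ω| ≤ g.1 ω := by
  rw [le_iff_ae]
  refine eventually_congr ?_
  filter_upwards [coeFn_abs f] with ω h1
  rw [h1]

lemma coeFn_zero : ∀ᵐ ω ∂μ, (0 : OrliczSpace φ μ).1 ω = 0 :=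
  AEEqFun.coeFn_zero

lemma nonneg_iff_ae {f : OrliczSpace φ μ} : 0 ≤ f ↔ ∀ᵐ ω ∂μ, 0 ≤ f.1 ω := by
  rw [le_iff_ae]
  refine eventually_congr ?_
  filter_upwards [coeFn_zero (φ := φ) (μ := μ)] with ω h1
  rw [h1]

lemma coeFn_inf (f g : OrliczSpace φ μ) : ∀ᵐ ω ∂μ, (f ⊓ g).1 ω = f.1 ω ⊓ g.1 ω :=
  AEEqFun.coeFn_inf f.1 g.1

lemma coeFn_add (f g : OrliczSpace φ μ) : ∀ᵐ ω ∂μ, (f + g).1 ω = f.1 ω + g.1 ω :=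
  AEEqFun.coeFn_add f.1 g.1

lemma coeFn_sub (f g : OrliczSpace φ μ) : ∀ᵐ ω ∂μ, (f - g).1 ω = f.1 ω - g.1 ω :=
  AEEqFun.coeFn_sub f.1 g.1

lemma coeFn_smul (c : ℝ) (f : OrliczSpace φ μ) : ∀ᵐ ω ∂μ, (c • f).1 ω = c * f.1 ω :=
  AEEqFun.coeFn_smul c f.1

lemma ext_ae {f g : OrliczSpace φ μ} (h : ∀ᵐ ω ∂μ, f.1 ω = g.1 ω) : f = g :=
  Subtype.ext (AEEqFun.ext h)

lemma aestronglyMeasurable (f : OrliczSpace φ μ) : AEStronglyMeasurable (fun ω => f.1 ω) μ :=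
  AEEqFun.aestronglyMeasurable f.1

lemma coeFn_cesaroSeq (f : ℕ → OrliczSpace φ μ) : ∀ᵐ ω ∂μ, ∀ m : ℕ,
    (cesaroSeq f m).1 ω = ((m : ℝ) + 1)⁻¹ * ∑ n ∈ Finset.range (m + 1), (f n).1 ω := by
  rw [ae_all_iff]
  intro m
  have h := AEEqFun.coeFn_finsetSum (μ := μ) (Finset.range (m + 1)) (fun n => (f n).1)
  filter_upwards [h, coeFn_smul ((m : ℝ) + 1)⁻¹ (∑ n ∈ Finset.range (m + 1), f n)] with ω h1 h2
  rw [cesaroSeq, h2, Submodule.coe_sum, h1, Finset.sum_apply]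

/-- A measurable function with some finite `φ`-integral represents an element of `L^φ`. -/
lemma exists_of_lintegral_lt_top {F : Ω → ℝ} (hF : AEStronglyMeasurable F μ) {c : ℝ} (hc : 0 < c)
    (h : ∫⁻ ω, ENNReal.ofReal (φ (|F ω| / c)) ∂μ ≠ ⊤) :
    ∃ f : OrliczSpace φ μ, ∀ᵐ ω ∂μ, f.1 ω = F ω := by
  set I := ∫⁻ ω, ENNReal.ofReal (φ (|F ω| / c)) ∂μ with hI
  set K : ℝ := max 1 I.toReal
  have hK : 1 ≤ K := le_max_left _ _
  have hK0 : 0 < K := by linarith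
  refine ⟨⟨AEEqFun.mk F hF, c * K, by positivity, ?_⟩, AEEqFun.coeFn_mk F hF⟩
  calc orliczIntegral φ μ (AEEqFun.mk F hF) (c * K)
      ≤ ∫⁻ ω, ENNReal.ofReal K⁻¹ * ENNReal.ofReal (φ (|F ω| / c)) ∂μ := by
        refine lintegral_mono_ae ?_
        filter_upwards [AEEqFun.coeFn_mk F hF] with ω h
        rw [h, ← ENNReal.ofReal_mul (by positivity)]
        refine ENNReal.ofReal_le_ofReal ?_
        rw [← div_div, inv_mul_eq_div]
        exact OrliczFunction.map_div_le (by positivity) hK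
    _ = ENNReal.ofReal K⁻¹ * I := lintegral_const_mul' _ _ ENNReal.ofReal_ne_top
    _ ≤ ENNReal.ofReal K⁻¹ * ENNReal.ofReal K := by
        gcongr
        rw [← ENNReal.ofReal_toReal h]
        exact ENNReal.ofReal_le_ofReal (le_max_right _ _)
    _ = 1 := by
        rw [← ENNReal.ofReal_mul (by positivity), inv_mul_cancel₀ hK0.ne', ENNReal.ofReal_one]

lemma exists_of_abs_le {F : Ω → ℝ} (hF : AEStronglyMeasurable F μ) (g : OrliczSpace φ μ)
    (h : ∀ᵐ ω ∂μ, |F ω| ≤ |g.1 ω|) : ∃ f : OrliczSpace φ μ, ∀ᵐ ω ∂μ, f.1 ω = F ω := by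
  refine ⟨⟨AEEqFun.mk F hF, mem_of_abs_le ?_ g.2⟩, AEEqFun.coeFn_mk F hF⟩
  rw [← AEEqFun.coeFn_le]
  filter_upwards [AEEqFun.coeFn_mk F hF, AEEqFun.coeFn_abs (AEEqFun.mk F hF),
    AEEqFun.coeFn_abs g.1, h] with ω h1 h2 h3 h4
  rwa [h2, h3, h1]

/-- Multiplication by a measurable function of modulus at most `1`, as an operator on `L^φ`. -/
lemma exists_mul_operator {m : Ω → ℝ} (hm : AEStronglyMeasurable m μ) (hm1 : ∀ ω, |m ω| ≤ 1) :
    ∃ M : OrliczSpace φ μ →L[ℝ] OrliczSpace φ μ,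
      (∀ f, ∀ᵐ ω ∂μ, (M f).1 ω = m ω * f.1 ω) ∧ ∀ f, |M f| ≤ |f| := by
  have key : ∀ f : OrliczSpace φ μ, ∃ g : OrliczSpace φ μ, ∀ᵐ ω ∂μ, g.1 ω = m ω * f.1 ω := by
    intro f
    refine exists_of_abs_le (hm.mul (aestronglyMeasurable f)) f (ae_of_all _ fun ω => ?_)
    rw [abs_mul]
    exact mul_le_of_le_one_left (abs_nonneg _) (hm1 ω)
  choose T hT using key
  have habs : ∀ f, |T f| ≤ |f| := by
    intro f
    rw [abs_le_abs_iff_ae]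
    filter_upwards [hT f] with ω h
    rw [h, abs_mul]
    exact mul_le_of_le_one_left (abs_nonneg _) (hm1 ω)
  refine ⟨LinearMap.mkContinuous
    { toFun := T
      map_add' := fun f g => ext_ae ?_
      map_smul' := fun c f => ext_ae ?_ } 1 fun f => ?_, hT, habs⟩
  · filter_upwards [hT f, hT g, hT (f + g), coeFn_add f g, coeFn_add (T f) (T g)]
      with ω h1 h2 h3 h4 h5
    rw [h3, h4, h5, h1, h2, mul_add]
  · filter_upwards [hT f, hT (c • f), coeFn_smul c f, coeFn_smul c (T f)] with ω h1 h2 h3 h4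
    rw [h2, h3, RingHom.id_apply, h4, h1, mul_left_comm]
  · rw [one_mul]
    exact HasSolidNorm.solid (habs f)

lemma orliczIntegral_le_one {f : OrliczSpace φ μ} {c : ℝ} (h : ‖f‖ < c) :
    orliczIntegral φ μ f.1 c ≤ 1 := by
  rw [norm_def] at h
  obtain ⟨d, hd, hdc⟩ := exists_lt_of_csInf_lt f.2 h
  exact (orliczIntegral_mono le_rfl hd.1 hdc.le).trans hd.2

lemma norm_le_of_orliczIntegral_le_one {f : OrliczSpace φ μ} {c : ℝ} (hc : 0 < c)
    (h : orliczIntegral φ μ f.1 c ≤ 1) : ‖f‖ ≤ c :=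
  csInf_le (luxemburgSet_bddBelow _) ⟨hc, h⟩

/-! ### Disjoint sequences -/

/-- Almost every point lies in the support of at most one member of a disjoint sequence. -/
lemma _root_.DisjointSeq.ae_single {f : ℕ → OrliczSpace φ μ} (hf : DisjointSeq f) :
    ∀ᵐ ω ∂μ, ∃ n₀, ∀ n, n ≠ n₀ → (f n).1 ω = 0 := by
  have h : ∀ᵐ ω ∂μ, ∀ i j, i ≠ j → |(f i).1 ω| ⊓ |(f j).1 ω| = 0 := by
    refine ae_all_iff.2 fun i => ae_all_iff.2 fun j => ?_
    by_cases hij : i = j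
    · exact ae_of_all _ fun _ hne => absurd hij hne
    filter_upwards [coeFn_abs (f i), coeFn_abs (f j), coeFn_inf |f i| |f j|,
      coeFn_zero (φ := φ) (μ := μ)] with ω h1 h2 h3 h4 _
    rw [← h1, ← h2, ← h3, hf i j hij, h4]
  filter_upwards [h] with ω h
  by_cases h0 : ∃ n₀, (f n₀).1 ω ≠ 0
  · obtain ⟨n₀, h0⟩ := h0
    refine ⟨n₀, fun n hn => ?_⟩
    by_contra hne
    have := h n n₀ hn
    have h1 : 0 < |(f n).1 ω| ⊓ |(f n₀).1 ω| := lt_inf_iff.2 ⟨abs_pos.2 hne, abs_pos.2 h0⟩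
    exact h1.ne' this
  · push Not at h0
    exact ⟨0, fun n _ => h0 n⟩

lemma disjointSeq_of_ae_single {f : ℕ → OrliczSpace φ μ}
    (hf : ∀ᵐ ω ∂μ, ∃ n₀, ∀ n, n ≠ n₀ → (f n).1 ω = 0) : DisjointSeq f := by
  intro i j hij
  refine ext_ae ?_
  filter_upwards [hf, coeFn_abs (f i), coeFn_abs (f j), coeFn_inf |f i| |f j|,
      coeFn_zero (φ := φ) (μ := μ)] with ω ⟨n₀, h0⟩ h1 h2 h3 h4
  rw [h3, h1, h2, h4]
  by_cases hi : i = n₀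
  · rw [h0 j (by rintro rfl; exact hij hi), abs_zero]
    exact inf_eq_right.2 (abs_nonneg _)
  · rw [h0 i hi, abs_zero]
    exact inf_eq_left.2 (abs_nonneg _)

lemma _root_.DisjointSeq.of_abs_le {f y : ℕ → OrliczSpace φ μ} (hf : DisjointSeq f)
    (h : ∀ n, |y n| ≤ |f n|) : DisjointSeq y := by
  refine disjointSeq_of_ae_single ?_
  have h' : ∀ᵐ ω ∂μ, ∀ n, |(y n).1 ω| ≤ |(f n).1 ω| :=
    ae_all_iff.2 fun n => abs_le_abs_iff_ae.1 (h n)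
  filter_upwards [hf.ae_single, h'] with ω ⟨n₀, h0⟩ h1
  refine ⟨n₀, fun n hn => ?_⟩
  have := h1 n
  rw [h0 n hn, abs_zero] at this
  exact abs_nonpos_iff.1 this

lemma _root_.DisjointSeq.comp {f : ℕ → OrliczSpace φ μ} (hf : DisjointSeq f) {k : ℕ → ℕ}
    (hk : StrictMono k) : DisjointSeq (f ∘ k) :=
  fun _ _ hij => hf _ _ (hk.injective.ne hij)

lemma aestronglyMeasurable_tsum_single {F : ℕ → Ω → ℝ} (hF : ∀ n, AEStronglyMeasurable (F n) μ)
    (h : ∀ᵐ ω ∂μ, ∃ n₀, ∀ n, n ≠ n₀ → F n ω = 0) :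
    AEStronglyMeasurable (fun ω => ∑' n, F n ω) μ := by
  refine aestronglyMeasurable_of_tendsto_ae atTop
    (f := fun N ω => ∑ n ∈ Finset.range N, F n ω)
    (fun N => Finset.aestronglyMeasurable_fun_sum _ fun n _ => hF n) ?_
  filter_upwards [h] with ω ⟨n₀, h0⟩
  exact (summable_of_ne_finset_zero (s := {n₀})
    fun n hn => h0 n (by simpa using hn)).hasSum.tendsto_sum_nat

/-- A sequence dominated in modulus by a disjoint sequence is its image under a single
multiplication operator of modulus at most `1`. -/
lemma _root_.DisjointSeq.exists_mask {f y : ℕ → OrliczSpace φ μ} (hf : DisjointSeq f)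
    (h : ∀ n, |y n| ≤ |f n|) :
    ∃ M : OrliczSpace φ μ →L[ℝ] OrliczSpace φ μ, (∀ n, M (f n) = y n) ∧ ∀ x, |M x| ≤ |x| := by
  have h' : ∀ᵐ ω ∂μ, ∀ n, |(y n).1 ω| ≤ |(f n).1 ω| :=
    ae_all_iff.2 fun n => abs_le_abs_iff_ae.1 (h n)
  set q : ℕ → Ω → ℝ := fun n ω => (y n).1 ω / (f n).1 ω
  have hq : ∀ᵐ ω ∂μ, ∃ n₀, ∀ n, n ≠ n₀ → q n ω = 0 := by
    filter_upwards [hf.ae_single] with ω ⟨n₀, h0⟩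
    exact ⟨n₀, fun n hn => by simp [q, h0 n hn]⟩
  -- truncation makes the bound `|m| ≤ 1` hold everywhere
  set m : Ω → ℝ := fun ω => max (-1) (min 1 (∑' n, q n ω))
  have hm : AEStronglyMeasurable m μ := by
    refine aestronglyMeasurable_const.sup (aestronglyMeasurable_const.inf
      (aestronglyMeasurable_tsum_single (fun n => ?_) hq))
    exact ((aestronglyMeasurable (y n)).aemeasurable.div
      (aestronglyMeasurable (f n)).aemeasurable).aestronglyMeasurable
  obtain ⟨M, hM, hM'⟩ := exists_mul_operator (φ := φ) hm fun ω => abs_le.2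
    ⟨le_max_left _ _, max_le (by norm_num) (min_le_left _ _)⟩
  refine ⟨M, fun n => ext_ae ?_, hM'⟩
  filter_upwards [hM (f n), hf.ae_single, h'] with ω h1 ⟨n₀, h0⟩ h2
  rw [h1]
  by_cases hn : (f n).1 ω = 0
  · have := h2 n
    rw [hn, abs_zero] at this
    rw [hn, mul_zero, abs_nonpos_iff.1 this]
  · have hn0 : n = n₀ := by
      by_contra hne
      exact hn (h0 n hne)
    have hsum : ∑' n, q n ω = q n ω :=
      tsum_eq_single n fun n' hn' => by simp [q, h0 n' (hn0 ▸ hn')]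
    have hle : |q n ω| ≤ 1 := by
      rw [abs_div]
      exact div_le_one_of_le₀ (h2 n) (abs_nonneg _)
    have : m ω = q n ω := by
      simp only [m, hsum]
      rw [min_eq_right (abs_le.1 hle).2, max_eq_right (abs_le.1 hle).1]
    rw [this, div_mul_cancel₀ _ hn]

/-- Dominated convergence for order convergence of sequences in `L^φ`. -/
lemma orderTendsto_zero_of_ae {f : ℕ → OrliczSpace φ μ} {h : OrliczSpace φ μ}
    (hf : ∀ n, |f n| ≤ h) (h0 : ∀ᵐ ω ∂μ, Tendsto (fun n => (f n).1 ω) atTop (𝓝 0)) :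
    OrderTendsto f atTop 0 := by
  have hf' : ∀ᵐ ω ∂μ, ∀ n, |(f n).1 ω| ≤ h.1 ω := ae_all_iff.2 fun n => abs_le_iff_ae.1 (hf n)
  refine ⟨{d | ∀ᶠ n in atTop, |f n| ≤ d}, ⟨h, Eventually.of_forall hf⟩, ?_, ⟨?_, ?_⟩, ?_⟩
  · exact fun d hd e he => ⟨d ⊓ e, (Eventually.and hd he).mono fun n hn => le_inf hn.1 hn.2,
      inf_le_left, inf_le_right⟩
  · rintro d hd
    obtain ⟨n, hn⟩ := Eventually.exists hd
    exact (abs_nonneg _).trans hn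
  · intro b hb
    -- the pointwise suprema of the tails belong to the directed set
    have hs : ∀ n, ∃ s : OrliczSpace φ μ, ∀ᵐ ω ∂μ, s.1 ω = ⨆ k, |(f (n + k)).1 ω| := by
      intro n
      refine exists_of_abs_le (Measurable.iSup fun k =>
        (f (n + k)).1.measurable.abs).aestronglyMeasurable h ?_
      filter_upwards [hf'] with ω h1
      rw [abs_of_nonneg (Real.iSup_nonneg fun k => abs_nonneg _)]
      exact ciSup_le fun k => (h1 _).trans (le_abs_self _)
    choose s hs using hs
    have hb' : ∀ᵐ ω ∂μ, ∀ n, b.1 ω ≤ (s n).1 ω := by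
      refine ae_all_iff.2 fun n => le_iff_ae.1 (hb ?_)
      refine eventually_atTop.2 ⟨n, fun j hj => abs_le_iff_ae.2 ?_⟩
      filter_upwards [hs n, hf'] with ω h1 h2
      rw [h1]
      obtain ⟨k, rfl⟩ := Nat.exists_eq_add_of_le hj
      exact le_ciSup (f := fun k => |(f (n + k)).1 ω|)
        ⟨h.1 ω, by rintro _ ⟨k, rfl⟩; exact h2 _⟩ k
    rw [le_iff_ae]
    filter_upwards [hb', ae_all_iff.2 hs, h0, coeFn_zero (φ := φ) (μ := μ)] with ω h1 h2 h3 h4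
    rw [h4]
    refine le_of_forall_pos_le_add fun ε hε => ?_
    obtain ⟨N, hN⟩ := Metric.tendsto_atTop.1 h3 ε hε
    refine (h1 N).trans ?_
    rw [h2, zero_add]
    refine ciSup_le fun k => ?_
    have := hN (N + k) (Nat.le_add_right _ _)
    rw [Real.dist_eq, sub_zero] at this
    exact this.le
  · intro d hd
    exact Eventually.mono hd fun n hn => by rwa [sub_zero]

lemma _root_.DisjointSeq.ae_tendsto_zero {f : ℕ → OrliczSpace φ μ} (hf : DisjointSeq f) :
    ∀ᵐ ω ∂μ, Tendsto (fun n => (f n).1 ω) atTop (𝓝 0) := by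
  filter_upwards [hf.ae_single] with ω ⟨n₀, h0⟩
  refine tendsto_const_nhds.congr' ?_
  filter_upwards [eventually_gt_atTop n₀] with n hn
  exact (h0 n hn.ne').symm

lemma _root_.DisjointSeq.uoTendsto {f : ℕ → OrliczSpace φ μ} (hf : DisjointSeq f) :
    UOTendsto f atTop 0 := by
  intro h hh
  refine orderTendsto_zero_of_ae (h := h) (fun n => ?_) ?_
  · rw [abs_of_nonneg (le_inf (abs_nonneg _) hh)]
    exact inf_le_right
  · refine (DisjointSeq.of_abs_le hf fun n => ?_).ae_tendsto_zero
    rw [abs_of_nonneg (le_inf (abs_nonneg _) hh), sub_zero]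
    exact inf_le_left

/-- The Cesàro means of a disjoint sequence tend to `0` almost everywhere, so for them order
convergence amounts to order boundedness. -/
lemma _root_.DisjointSeq.orderTendsto_cesaroSeq {f : ℕ → OrliczSpace φ μ} (hf : DisjointSeq f)
    (hb : OrderBdd (range (cesaroSeq f))) : OrderTendsto (cesaroSeq f) atTop 0 := by
  obtain ⟨h, -, hh⟩ := hb
  refine orderTendsto_zero_of_ae (fun n => hh _ ⟨n, rfl⟩) ?_
  filter_upwards [hf.ae_tendsto_zero, coeFn_cesaroSeq f] with ω h1 h2
  refine ((tendsto_add_atTop_iff_nat 1).2 h1.cesaro).congr fun _ => ?_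
  rw [h2, Nat.cast_add_one]

/-- The Cesàro means of a disjoint sequence are bounded by `∑ |f n| / (n + 1)`, whose
`φ`-integral is the sum of those of its terms. -/
lemma _root_.DisjointSeq.orderBdd_cesaroSeq {f : ℕ → OrliczSpace φ μ} (hf : DisjointSeq f)
    {c : ℝ} (hc : 0 < c) (h : ∑' n : ℕ, orliczIntegral φ μ (f n).1 (((n : ℝ) + 1) * c) ≠ ⊤) :
    OrderBdd (range (cesaroSeq f)) := by
  set F : ℕ → Ω → ℝ := fun n ω => |(f n).1 ω| / ((n : ℝ) + 1)
  have hF : ∀ᵐ ω ∂μ, ∃ n₀, ∀ n, n ≠ n₀ → F n ω = 0 := by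
    filter_upwards [hf.ae_single] with ω ⟨n₀, h0⟩
    exact ⟨n₀, fun n hn => by simp [F, h0 n hn]⟩
  have hF0 : ∀ n ω, 0 ≤ F n ω := fun n ω => by positivity
  have hm := aestronglyMeasurable_tsum_single
    (fun n => ((f n).1.measurable.abs.div_const _).aestronglyMeasurable) hF
  obtain ⟨s, hs⟩ := exists_of_lintegral_lt_top (φ := φ) hm hc (by
    refine ne_top_of_le_ne_top h ?_
    unfold orliczIntegral
    rw [← lintegral_tsum fun n => (orlicz_measurable _ (by positivity)).aemeasurable]
    refine lintegral_mono_ae ?_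
    filter_upwards [hF] with ω ⟨n₀, h0⟩
    rw [tsum_eq_single n₀ h0, abs_of_nonneg (hF0 _ _)]
    refine le_trans (le_of_eq ?_) (ENNReal.le_tsum n₀)
    simp only [F, div_div])
  refine ⟨s, nonneg_iff_ae.2 (hs.mono fun ω h => h ▸ tsum_nonneg fun n => hF0 n ω), ?_⟩
  rintro _ ⟨m, rfl⟩
  rw [abs_le_iff_ae]
  filter_upwards [hs, hF, coeFn_cesaroSeq f] with ω h1 ⟨n₀, h0⟩ h2
  rw [h1, h2, abs_mul, abs_of_pos (a := ((m : ℝ) + 1)⁻¹) (by positivity)]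
  calc ((m : ℝ) + 1)⁻¹ * |∑ n ∈ Finset.range (m + 1), (f n).1 ω|
      ≤ ((m : ℝ) + 1)⁻¹ * ∑ n ∈ Finset.range (m + 1), |(f n).1 ω| := by
        gcongr
        exact Finset.abs_sum_le_sum_abs _ _
    _ = ∑ n ∈ Finset.range (m + 1), ((m : ℝ) + 1)⁻¹ * |(f n).1 ω| := Finset.mul_sum _ _ _
    _ ≤ ∑ n ∈ Finset.range (m + 1), F n ω := by
        refine Finset.sum_le_sum fun n hn => ?_
        simp only [F]
        rw [inv_mul_eq_div]
        have : (n : ℝ) ≤ m := by exact_mod_cast Nat.lt_succ_iff.1 (Finset.mem_range.1 hn)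
        gcongr
    _ ≤ ∑' n, F n ω := Summable.sum_le_tsum _ (fun n _ => hF0 n ω)
        (summable_of_ne_finset_zero (s := {n₀}) fun n hn => h0 n (by simpa using hn))

end OrliczSpace

end Orlicz

/-! ### Conjugate Orlicz functions and the `Δ₂`-condition -/

namespace OrliczFunction

lemma tendsto_atTop (φ : OrliczFunction) : Tendsto φ.toFun atTop atTop := by
  obtain ⟨t, ht, hφt⟩ := φ.nonconst'
  have hφt' : 0 < φ t := lt_of_le_of_ne (φ.nonneg ht) (Ne.symm hφt)
  have ht' : 0 < t := lt_of_le_of_ne ht (by rintro rfl; exact hφt φ.map_zero')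
  refine tendsto_atTop_mono' atTop (f₁ := fun u => u * (φ t / t)) ?_
    (tendsto_id.atTop_mul_const (by positivity))
  filter_upwards [eventually_ge_atTop t] with u hu
  have h := map_div_le (φ := φ) (x := u) (K := u / t) (by linarith) ((one_le_div ht').2 hu)
  have hu0 : 0 < u := by linarith
  rw [div_div_cancel₀ hu0.ne', le_div_iff₀ (by positivity)] at h
  calc u * (φ t / t) = φ t * (u / t) := by ring
    _ ≤ _ := h

/-- A supporting line of an Orlicz function at a positive point. -/
lemma exists_subgradient (φ : OrliczFunction) {t : ℝ} (ht : 0 < t) :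
    ∃ s, 0 ≤ s ∧ ∀ u, 0 ≤ u → φ t + s * (u - t) ≤ φ u := by
  set S : Set ℝ := {r | ∃ u, 0 ≤ u ∧ u < t ∧ r = (φ t - φ u) / (t - u)}
  have hS : ∀ v, t < v → ∀ r ∈ S, r ≤ (φ v - φ t) / (v - t) := by
    rintro v hv r ⟨u, hu, hut, rfl⟩
    exact φ.convexOn'.slope_mono_adjacent (mem_Ici.2 hu) (mem_Ici.2 (ht.trans hv).le) hut hv
  have hbdd : BddAbove S := ⟨_, hS (t + 1) (by linarith)⟩
  have hmem : ∀ u, 0 ≤ u → u < t → (φ t - φ u) / (t - u) ≤ sSup S := fun u hu hut =>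
    le_csSup hbdd ⟨u, hu, hut, rfl⟩
  refine ⟨sSup S, ?_, fun u hu => ?_⟩
  · refine le_trans ?_ (hmem 0 le_rfl ht)
    rw [φ.map_zero', sub_zero, sub_zero]
    exact div_nonneg (φ.nonneg ht.le) ht.le
  · rcases lt_trichotomy u t with h | h | h
    · have := hmem u hu h
      rw [div_le_iff₀ (by linarith)] at this
      linarith
    · simp [h]
    · have : sSup S ≤ (φ u - φ t) / (u - t) := csSup_le ⟨_, 0, le_rfl, ht, rfl⟩ (hS u h)
      rw [le_div_iff₀ (by linarith)] at this
      linarith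

variable {φ ψ : OrliczFunction}

lemma IsConjugate.mul_le_add (h : φ.IsConjugate ψ) {s t : ℝ} (hs : 0 ≤ s) (ht : 0 ≤ t) :
    s * t ≤ φ t + ψ s := by
  have := (h s hs).1 ⟨t, ht, rfl⟩
  linarith

/-- If the conjugate of `φ` satisfies `Δ₂`, then `φ` grows strictly faster than linearly under
dilation. The slope `s` of a supporting line at `t` gives equality in Young's inequality
`s t ≤ φ t + ψ s`, and `Δ₂` is applied at `s`. -/
lemma IsConjugate.exists_mul_le_of_deltaTwo (h : φ.IsConjugate ψ) (hψ : ψ.DeltaTwo) :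
    ∃ l : ℕ, 2 ≤ l ∧ ∃ t₀ > 0, ∀ t ≥ t₀, 2 * (l : ℝ) * φ t ≤ φ (l * t) := by
  obtain ⟨C, -, s₀, hs₀, hC⟩ := hψ
  obtain ⟨l, hl⟩ := exists_nat_ge (max C 2)
  have hlC : C ≤ l := (le_max_left _ _).trans hl
  have hl2 : (2 : ℝ) ≤ l := (le_max_right _ _).trans hl
  have hψ0 : 0 ≤ ψ (s₀ + 1) := ψ.nonneg (by linarith)
  refine ⟨l, by exact_mod_cast hl2, ψ (s₀ + 1) + 1, by linarith, fun t ht => ?_⟩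
  have ht0 : 0 < t := by linarith
  obtain ⟨s, hs, hsub⟩ := φ.exists_subgradient ht0
  have hψs : ψ s ≤ s * t - φ t := by
    refine (h s hs).2 ?_
    rintro _ ⟨u, hu, rfl⟩
    have := hsub u hu
    linarith
  -- the slope `s ≥ φ t / t` exceeds `s₀` by Young's inequality
  have hs0 : s₀ < s := by
    have h1 := hsub 0 le_rfl
    have h2 := h.mul_le_add (s := s₀ + 1) (by linarith) ht0.le
    rw [φ.map_zero'] at h1
    by_contra hcon
    nlinarith
  have h3 := h.mul_le_add (s := 2 * s) (t := l * t) (by linarith) (by positivity)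
  have h4 := hC s hs0
  have h5 := ψ.nonneg hs
  nlinarith

/-- Converse of `IsConjugate.exists_mul_le_of_deltaTwo`. -/
lemma IsConjugate.deltaTwo_of_forall_mul_le (h : φ.IsConjugate ψ) {l t₀ : ℝ} (hl : 1 ≤ l)
    (ht₀ : 0 < t₀) (hφ : ∀ t ≥ t₀, 2 * l * φ t ≤ φ (l * t)) : ψ.DeltaTwo := by
  have hφ1 : 0 ≤ φ 1 := φ.nonneg zero_le_one
  refine ⟨2 * l + 4 * l * t₀, by positivity, 2 * φ 1 + 1, by linarith, fun s hs => ?_⟩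
  have hs0 : 0 < s := by linarith
  have hψs : s / 2 ≤ ψ s := by
    have := h.mul_le_add hs0.le zero_le_one
    linarith
  have hlt : 0 < l * t₀ := by positivity
  refine (h (2 * s) (by linarith)).2 ?_
  rintro _ ⟨t, ht, rfl⟩
  have hu : l * (t / l) = t := by field_simp
  rcases le_total t₀ (t / l) with h1 | h1
  · have h2 := hφ _ h1
    have h3 := h.mul_le_add (s := s) (t := t / l) hs0.le (by positivity)
    rw [hu] at h2
    calc 2 * s * t - φ t ≤ 2 * s * t - 2 * l * φ (t / l) := by linarith
      _ = 2 * l * (s * (t / l) - φ (t / l)) := by field_simp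
      _ ≤ 2 * l * ψ s := by
        gcongr
        linarith
      _ ≤ _ := by nlinarith
  · have h2 : t ≤ l * t₀ := by rw [← hu]; gcongr
    have h3 := φ.nonneg ht
    calc 2 * s * t - φ t ≤ 2 * s * (l * t₀) := by nlinarith
      _ = 4 * (l * t₀) * (s / 2) := by ring
      _ ≤ 4 * (l * t₀) * ψ s := by gcongr
      _ ≤ _ := by nlinarith

/-- If the conjugate of `φ` fails `Δ₂`, then `φ` is almost linear on intervals `[a / l, a]` with
`a` and `l` arbitrarily large. -/
lemma IsConjugate.exists_almost_linear (h : φ.IsConjugate ψ) (hψ : ¬ ψ.DeltaTwo) {l : ℝ}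
    (hl : 1 ≤ l) (T : ℝ) :
    ∃ a, 0 < a ∧ T ≤ φ a ∧ ∀ s, 1 ≤ s → s ≤ l → φ a / (2 * s) ≤ φ (a / s) := by
  obtain ⟨t₁, ht₁⟩ := eventually_atTop.1 (φ.tendsto_atTop.eventually_ge_atTop T)
  have h1 : ∃ t ≥ max 1 t₁, φ (l * t) < 2 * l * φ t := by
    by_contra! hcon
    exact hψ (h.deltaTwo_of_forall_mul_le hl (by positivity) hcon)
  obtain ⟨t, ht, hlt⟩ := h1
  have ht1 : 1 ≤ t := (le_max_left _ _).trans ht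
  refine ⟨l * t, by positivity, (ht₁ t ((le_max_right _ _).trans ht)).trans
    (φ.mono (by linarith) (le_mul_of_one_le_left (by linarith) hl)), fun s hs hsl => ?_⟩
  have hs0 : 0 < s := by linarith
  have h2 := map_div_le (φ := φ) (x := l * t / s) (K := l / s) (by positivity)
    ((one_le_div hs0).2 hsl)
  have e : l * t / s / (l / s) = t := by field_simp
  rw [e, le_div_iff₀ (by positivity)] at h2
  refine le_trans ?_ h2
  rw [div_le_iff₀ (by positivity)]
  calc φ (l * t) ≤ 2 * l * φ t := hlt.le
    _ = φ t * (l / s) * (2 * s) := by field_simp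

lemma pow_mul_le_of_mul_le {l : ℕ} {t₀ : ℝ} (hl : 2 ≤ l) (ht₀ : 0 < t₀)
    (hφ : ∀ t ≥ t₀, 2 * (l : ℝ) * φ t ≤ φ (l * t)) (k : ℕ) {t : ℝ} (ht : t₀ ≤ t) :
    (2 * (l : ℝ)) ^ k * φ t ≤ φ ((l : ℝ) ^ k * t) := by
  have hl1 : (1 : ℝ) ≤ l := by exact_mod_cast (by omega : 1 ≤ l)
  induction k with
  | zero => simp
  | succ k ih =>
    have h1 : t₀ ≤ (l : ℝ) ^ k * t :=
      ht.trans (le_mul_of_one_le_left (by linarith) (one_le_pow₀ hl1))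
    calc (2 * (l : ℝ)) ^ (k + 1) * φ t = 2 * l * ((2 * (l : ℝ)) ^ k * φ t) := by ring
      _ ≤ 2 * l * φ ((l : ℝ) ^ k * t) := by gcongr
      _ ≤ φ (l * ((l : ℝ) ^ k * t)) := hφ _ h1
      _ = φ ((l : ℝ) ^ (k + 1) * t) := by rw [pow_succ']; ring_nf

lemma map_div_natCast_le {l : ℕ} {t₀ : ℝ} (hl : 2 ≤ l) (ht₀ : 0 < t₀)
    (hφ : ∀ t ≥ t₀, 2 * (l : ℝ) * φ t ≤ φ (l * t)) {n : ℕ} (hn : n ≠ 0) {t : ℝ} (ht : 0 ≤ t) :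
    φ (t / n) ≤ ((2 * (l : ℝ)) ^ Nat.log l n)⁻¹ * φ t + φ t₀ := by
  have hn0 : (0 : ℝ) < n := by exact_mod_cast Nat.pos_of_ne_zero hn
  have hl0 : (0 : ℝ) < l := by exact_mod_cast (by omega : 0 < l)
  rcases le_total t₀ (t / n) with h | h
  · have h1 := pow_mul_le_of_mul_le hl ht₀ hφ (Nat.log l n) h
    have h2 : (l : ℝ) ^ Nat.log l n * (t / n) ≤ t := by
      have : (l : ℝ) ^ Nat.log l n ≤ n := by exact_mod_cast Nat.pow_log_le_self l hn
      calc (l : ℝ) ^ Nat.log l n * (t / n) ≤ n * (t / n) := by gcongr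
        _ = t := by field_simp
    have h3 := h1.trans (φ.mono (by positivity) h2)
    rw [← le_inv_mul_iff₀ (by positivity)] at h3
    exact h3.trans (le_add_of_nonneg_right (φ.nonneg ht₀.le))
  · refine (φ.mono (by positivity) h).trans (le_add_of_nonneg_left ?_)
    have := φ.nonneg ht
    positivity

/-- With `p = log_l (2 l) > 1`, the summand is at most `2 l (n + 1) ^ (-p)`. -/
lemma summable_inv_pow_log {l : ℕ} (hl : 2 ≤ l) :
    Summable fun n : ℕ => ((2 * (l : ℝ)) ^ Nat.log l (n + 1))⁻¹ := by
  have hl1 : (1 : ℝ) < l := by exact_mod_cast (by omega : 1 < l)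
  have hl0 : (0 : ℝ) < l := by linarith
  set p : ℝ := Real.logb l (2 * l)
  have hp : 1 < p := by
    rw [Real.lt_logb_iff_rpow_lt hl1 (by positivity), Real.rpow_one]
    linarith
  have hlp : (l : ℝ) ^ p = 2 * l := Real.rpow_logb hl0 hl1.ne' (by positivity)
  have hs : Summable fun n : ℕ => (2 * (l : ℝ)) * (((n + 1 : ℕ) : ℝ) ^ p)⁻¹ :=
    ((summable_nat_add_iff 1).2 (Real.summable_nat_rpow_inv.2 hp)).mul_left _
  refine hs.of_nonneg_of_le (fun n => by positivity) fun n => ?_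
  have h1 : (((n + 1 : ℕ) : ℝ)) ≤ (l : ℝ) ^ (Nat.log l (n + 1) + 1) := by
    exact_mod_cast (Nat.lt_pow_succ_log_self (by omega) (n + 1)).le
  have h2 : ((n + 1 : ℕ) : ℝ) ^ p ≤ (2 * l : ℝ) ^ (Nat.log l (n + 1) + 1) := by
    calc ((n + 1 : ℕ) : ℝ) ^ p ≤ ((l : ℝ) ^ (Nat.log l (n + 1) + 1)) ^ p := by gcongr
      _ = ((l : ℝ) ^ p) ^ (Nat.log l (n + 1) + 1) := by
        rw [← Real.rpow_natCast, ← Real.rpow_natCast, ← Real.rpow_mul hl0.le,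
          ← Real.rpow_mul hl0.le, mul_comm]
      _ = _ := by rw [hlp]
  rw [← div_eq_mul_inv, le_div_iff₀ (by positivity), inv_mul_le_iff₀ (by positivity), mul_comm]
  rw [pow_succ] at h2
  linarith

end OrliczFunction

/-! ### The disjoint order Banach–Saks property and `Δ₂` -/

namespace OrliczSpace

/-- Splitting `φ(t / (n + 1))` into a summable multiple of `φ t` and a constant carried by the
disjoint supports bounds the sum of the `φ`-integrals of `|f n| / (n + 1)`. -/
lemma doBSP_of_deltaTwo {Ω : Type*} [MeasurableSpace Ω] {φ ψ : OrliczFunction} {μ : Measure Ω}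
    [IsFiniteMeasure μ] (h : φ.IsConjugate ψ) (hψ : ψ.DeltaTwo) : DoBSP (OrliczSpace φ μ) := by
  rintro f ⟨M, hM⟩ hf
  refine ⟨id, strictMono_id, 0, hf.orderTendsto_cesaroSeq ?_⟩
  obtain ⟨l, hl, t₀, ht₀, hφ⟩ := h.exists_mul_le_of_deltaTwo hψ
  have hM0 : 0 ≤ M := (norm_nonneg _).trans (hM 0)
  have hc : 0 < M + 1 := by linarith
  refine hf.orderBdd_cesaroSeq hc ?_
  set d : ℕ → ℝ := fun n => ((2 * (l : ℝ)) ^ Nat.log l (n + 1))⁻¹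
  have hd : ∀ n, 0 ≤ d n := fun n => by positivity
  set B : ℕ → Ω → ENNReal := fun n ω => {ω | (f n).1 ω ≠ 0}.indicator
    (fun _ => ENNReal.ofReal (φ t₀)) ω
  have hBm : ∀ n, Measurable (B n) := fun n => measurable_const.indicator
    ((f n).1.measurable (measurableSet_singleton 0).compl)
  have hterm : ∀ n, orliczIntegral φ μ (f n).1 (((n : ℝ) + 1) * (M + 1)) ≤
      ENNReal.ofReal (d n) + ∫⁻ ω, B n ω ∂μ := by
    intro n
    calc orliczIntegral φ μ (f n).1 (((n : ℝ) + 1) * (M + 1))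
        ≤ ∫⁻ ω, (ENNReal.ofReal (d n) * ENNReal.ofReal (φ (|(f n).1 ω| / (M + 1))) + B n ω) ∂μ := by
          refine lintegral_mono fun ω => ?_
          by_cases h0 : (f n).1 ω = 0
          · simp [h0, φ.map_zero']
          have hx : 0 ≤ |(f n).1 ω| / (M + 1) := by positivity
          have hB : B n ω = ENNReal.ofReal (φ t₀) := indicator_of_mem (by exact h0) _
          rw [hB, ← ENNReal.ofReal_mul (hd n), ← ENNReal.ofReal_add
            (mul_nonneg (hd n) (φ.nonneg hx)) (φ.nonneg ht₀.le)]
          refine ENNReal.ofReal_le_ofReal ?_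
          have := OrliczFunction.map_div_natCast_le hl ht₀ hφ n.succ_ne_zero hx
          rwa [div_div, mul_comm, Nat.cast_succ] at this
      _ = ENNReal.ofReal (d n) * orliczIntegral φ μ (f n).1 (M + 1) + ∫⁻ ω, B n ω ∂μ := by
          rw [lintegral_add_right _ (hBm n), lintegral_const_mul' _ _ ENNReal.ofReal_ne_top]
          rfl
      _ ≤ ENNReal.ofReal (d n) * 1 + ∫⁻ ω, B n ω ∂μ := by
          gcongr
          exact orliczIntegral_le_one ((hM n).trans_lt (by linarith))
      _ = _ := by rw [mul_one]
  refine ne_top_of_le_ne_top ?_ (ENNReal.tsum_le_tsum hterm)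
  rw [ENNReal.tsum_add]
  refine ENNReal.add_ne_top.2 ⟨(OrliczFunction.summable_inv_pow_log hl).tsum_ofReal_ne_top, ?_⟩
  rw [← lintegral_tsum fun n => (hBm n).aemeasurable]
  refine ne_top_of_le_ne_top (b := ∫⁻ _, ENNReal.ofReal (φ t₀) ∂μ) ?_ (lintegral_mono_ae ?_)
  · rw [lintegral_const]
    exact ENNReal.mul_ne_top ENNReal.ofReal_ne_top (measure_ne_top _ _)
  · filter_upwards [hf.ae_single] with ω ⟨n₀, h0⟩
    rw [tsum_eq_single n₀ fun n hn => indicator_of_notMem (by simpa using h0 n hn) _]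
    exact indicator_le_self' (fun _ _ => bot_le) ω

/-- If the conjugate of `φ` fails `Δ₂`, normalised indicators `a n • 1_{A n}` of disjoint sets, at
heights `a n` below which `φ` is almost linear, satisfy
`∫ φ(a n / (c (n + 1))) 1_{A n} ≥ 1 / (2 c (n + 1))`; by divergence of the harmonic series no
subsequence has order bounded Cesàro means. -/
lemma deltaTwo_of_doBSP {φ ψ : OrliczFunction} (h : φ.IsConjugate ψ)
    (hBS : DoBSP (OrliczSpace φ unitLebesgue)) : ψ.DeltaTwo := by
  by_contra hψ
  choose a ha hTa haφ using fun n : ℕ => h.exists_almost_linear hψ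
    (l := ((n : ℝ) + 1) ^ 2) (one_le_pow₀ (by linarith [n.cast_nonneg (α := ℝ)]))
    (2 ^ (n + 1))
  have hφa : ∀ n, 0 < φ (a n) := fun n => lt_of_lt_of_le (by positivity) (hTa n)
  set A : ℕ → Set ℝ := fun n =>
    Ioc ((1 / 2 : ℝ) ^ (n + 1)) ((1 / 2 : ℝ) ^ (n + 1) + (φ (a n))⁻¹)
  have hAm : ∀ n, MeasurableSet (A n) := fun n => measurableSet_Ioc
  have hAsub : ∀ n, A n ⊆ Ioc ((1 / 2 : ℝ) ^ (n + 1)) ((1 / 2 : ℝ) ^ n) := by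
    intro n
    refine Ioc_subset_Ioc_right ?_
    have h1 : (φ (a n))⁻¹ ≤ (1 / 2 : ℝ) ^ (n + 1) := by
      rw [one_div, inv_pow]
      exact inv_anti₀ (by positivity) (hTa n)
    calc (1 / 2 : ℝ) ^ (n + 1) + (φ (a n))⁻¹ ≤ (1 / 2 : ℝ) ^ (n + 1) + (1 / 2 : ℝ) ^ (n + 1) := by
          linarith
      _ = (1 / 2 : ℝ) ^ n := by rw [pow_succ]; ring
  have hAd : ∀ i j, i < j → Disjoint (A i) (A j) := by
    intro i j hij
    refine Set.disjoint_left.2 fun x hi hj => ?_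
    have h1 := (hAsub i hi).1
    have h2 := (hAsub j hj).2
    have h3 : (1 / 2 : ℝ) ^ j ≤ (1 / 2 : ℝ) ^ (i + 1) :=
      pow_le_pow_of_le_one (by norm_num) (by norm_num) hij
    linarith
  have hAd' : Pairwise (Function.onFun Disjoint A) := fun i j hij =>
    (lt_or_gt_of_ne hij).elim (hAd i j) fun h => (hAd j i h).symm
  have hAμ : ∀ n, unitLebesgue (A n) = ENNReal.ofReal (φ (a n))⁻¹ := by
    intro n
    rw [Measure.restrict_apply (hAm n), inter_eq_left.2, Real.volume_Ioc, add_sub_cancel_left]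
    exact (hAsub n).trans fun x hx => ⟨(lt_trans (by positivity) hx.1).le,
      hx.2.trans (pow_le_one₀ (by norm_num) (by norm_num))⟩
  have hint : ∀ n, ∫⁻ ω, ENNReal.ofReal (φ (|(A n).indicator (fun _ => a n) ω| / 1))
      ∂unitLebesgue = 1 := by
    intro n
    have : (fun ω => ENNReal.ofReal (φ (|(A n).indicator (fun _ => a n) ω| / 1)))
        = (A n).indicator fun _ => ENNReal.ofReal (φ (a n)) := by
      funext ω
      by_cases hω : ω ∈ A n
      · simp [hω, abs_of_pos (ha n)]
      · simp [hω, φ.map_zero']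
    rw [this, lintegral_indicator_const (hAm n), hAμ, ← ENNReal.ofReal_mul (hφa n).le,
      mul_inv_cancel₀ (hφa n).ne', ENNReal.ofReal_one]
  choose f hf using fun n => exists_of_lintegral_lt_top (φ := φ) (μ := unitLebesgue)
    (F := (A n).indicator (fun _ => a n))
    (measurable_const.indicator (hAm n)).aestronglyMeasurable one_pos
    (by rw [hint]; exact ENNReal.one_ne_top)
  have hfb : NormBddSeq f := by
    refine ⟨1, fun n => norm_le_of_orliczIntegral_le_one one_pos (le_of_eq ?_)⟩
    rw [← hint n]
    refine lintegral_congr_ae ?_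
    filter_upwards [hf n] with ω h1
    rw [h1]
  have hfd : DisjointSeq f := by
    refine disjointSeq_of_ae_single ?_
    filter_upwards [ae_all_iff.2 hf] with ω h1
    by_cases h2 : ∃ n₀, ω ∈ A n₀
    · obtain ⟨n₀, h2⟩ := h2
      refine ⟨n₀, fun n hn => ?_⟩
      rw [h1, indicator_of_notMem]
      exact Set.disjoint_right.1 (hAd' hn) h2
    · push Not at h2
      exact ⟨0, fun n _ => by rw [h1, indicator_of_notMem (h2 n)]⟩
  obtain ⟨k, hk, x, hx⟩ := hBS f hfb hfd
  obtain ⟨g, -, hg⟩ := hx.orderBdd_range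
  obtain ⟨c₀, hc₀, hgc₀⟩ := g.2
  set c : ℝ := max 1 c₀
  have hc1 : 1 ≤ c := le_max_left _ _
  have hgc : orliczIntegral φ unitLebesgue g.1 c ≤ 1 :=
    (orliczIntegral_mono le_rfl hc₀ (le_max_right _ _)).trans hgc₀
  obtain ⟨N, hN⟩ := exists_nat_ge c
  -- `g` dominates the term of index `n` divided by `n + 1` on its support
  have hlow : ∀ᵐ ω ∂unitLebesgue, ∀ n : ℕ, ω ∈ A (k n) →
      a (k n) / ((n : ℝ) + 1) ≤ |g.1 ω| := by
    have hg' : ∀ᵐ ω ∂unitLebesgue, ∀ m, |(cesaroSeq (f ∘ k) m).1 ω| ≤ g.1 ω :=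
      ae_all_iff.2 fun m => abs_le_iff_ae.1 (hg _ ⟨m, rfl⟩)
    filter_upwards [hg', ae_all_iff.2 hf, coeFn_cesaroSeq (f ∘ k)] with ω h1 h2 h3 n hn
    refine le_trans (le_of_eq ?_) ((h1 n).trans (le_abs_self _))
    rw [h3, Finset.sum_eq_single_of_mem n (by simp)]
    · rw [Function.comp_apply, h2, indicator_of_mem hn, inv_mul_eq_div, abs_of_pos]
      have := ha (k n)
      positivity
    · intro i _ hi
      rw [Function.comp_apply, h2, indicator_of_notMem]
      exact Set.disjoint_right.1 (hAd' (hk.injective.ne hi)) hn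
  have hterm : ∀ n : ℕ, ENNReal.ofReal (1 / (2 * c * (((n + N : ℕ) : ℝ) + 1))) ≤
      ∫⁻ ω in A (k (n + N)), ENNReal.ofReal (φ (|g.1 ω| / c)) ∂unitLebesgue := by
    intro n
    set m := n + N
    have hm0 : (0 : ℝ) ≤ m := m.cast_nonneg
    have hcm : c ≤ m := hN.trans (by exact_mod_cast Nat.le_add_left N n)
    have hmk : (m : ℝ) ≤ k m := by exact_mod_cast hk.id_le m
    have hak := ha (k m)
    have hs : φ (a (k m)) / (2 * (c * (m + 1))) ≤ φ (a (k m) / (c * (m + 1))) := by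
      refine haφ (k m) _ (one_le_mul_of_one_le_of_one_le hc1 (by linarith)) ?_
      rw [sq]
      gcongr
      linarith
    calc ENNReal.ofReal (1 / (2 * c * ((m : ℝ) + 1)))
        = ENNReal.ofReal (φ (a (k m)) / (2 * (c * (m + 1)))) * unitLebesgue (A (k m)) := by
          have := hφa (k m)
          rw [hAμ, ← ENNReal.ofReal_mul (by positivity)]
          congr 1
          field_simp
      _ = ∫⁻ ω in A (k m), ENNReal.ofReal (φ (a (k m)) / (2 * (c * (m + 1)))) ∂unitLebesgue :=
          (setLIntegral_const _ _).symm
      _ ≤ _ := by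
          refine setLIntegral_mono_ae' (hAm _) ?_
          filter_upwards [hlow] with ω h1 hω
          refine ENNReal.ofReal_le_ofReal (hs.trans (φ.mono (by positivity) ?_))
          rw [mul_comm c, ← div_div]
          have := h1 m hω
          gcongr
  have hsum : ∑' n : ℕ, ENNReal.ofReal (1 / (2 * c * (((n + N : ℕ) : ℝ) + 1))) ≤ 1 := by
    refine (ENNReal.tsum_le_tsum hterm).trans ?_
    rw [← lintegral_iUnion (fun n => hAm _)]
    · exact (setLIntegral_le_lintegral _ _).trans hgc
    · exact fun i j hij => hAd' (hk.injective.ne (by simpa using hij))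
  have hsummable := ENNReal.summable_toReal (ne_top_of_le_ne_top ENNReal.one_ne_top hsum)
  have h2 : Summable fun n : ℕ => 1 / ((n : ℝ) + 1) := by
    rw [← summable_nat_add_iff N]
    refine (hsummable.mul_left (2 * c)).congr fun n => ?_
    rw [ENNReal.toReal_ofReal (by positivity)]
    field_simp
  exact Real.not_summable_one_div_natCast
    ((summable_nat_add_iff 1).1 (h2.congr fun n => by rw [Nat.cast_add_one]))

/-- Every norm bounded disjoint sequence is null for the absolute weak topology of the uo-dual,
since the disjoint sequences it dominates are uo-null. -/
lemma absSigmaNull_uoDual {Ω : Type} [MeasurableSpace Ω] {φ : OrliczFunction} {μ : Measure Ω}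
    {f : ℕ → OrliczSpace φ μ} (hb : NormBddSeq f) (hf : DisjointSeq f) :
    AbsSigmaNull (uoDual (OrliczSpace φ μ)) f := by
  intro g hg
  refine tendsto_dualAbs_of_dominated fun y hy => ?_
  obtain ⟨M, hM⟩ := hb
  exact hg ℕ y ⟨M, fun n => (HasSolidNorm.solid (hy n)).trans (hM n)⟩ (hf.of_abs_le hy).uoTendsto

end OrliczSpace

/-! ### Order continuous functionals given by integration -/

namespace OrliczSpace

section Integral

variable {Ω : Type*} [MeasurableSpace Ω] {φ : OrliczFunction} {μ : Measure Ω}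

/-- Along a downward directed set with infimum `0`, integrals against `|w|` become arbitrarily
small. A decreasing sequence `d n` of the set that minimises the integral has, where `w ≠ 0`, a
pointwise infimum below every member of the set, hence equal to `0`. -/
lemma exists_integral_lt_of_isGLB {w : Ω → ℝ} (hw : Measurable w)
    (hint : ∀ f : OrliczSpace φ μ, Integrable (fun ω => f.1 ω * w ω) μ)
    {D : Set (OrliczSpace φ μ)} (hD : D.Nonempty) (hdir : DirectedOn (· ≥ ·) D)
    (hglb : IsGLB D 0) {ε : ℝ} (hε : 0 < ε) :
    ∃ d ∈ D, ∫ ω, d.1 ω * |w ω| ∂μ < ε := by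
  have hint' : ∀ f : OrliczSpace φ μ, Integrable (fun ω => f.1 ω * |w ω|) μ := fun f =>
    (hint f).mono ((aestronglyMeasurable f).mul hw.abs.aestronglyMeasurable)
      (ae_of_all _ fun ω => by simp)
  set J : OrliczSpace φ μ → ℝ := fun d => ∫ ω, d.1 ω * |w ω| ∂μ with hJ
  have hpos : ∀ d ∈ D, ∀ᵐ ω ∂μ, 0 ≤ d.1 ω := fun d hd => nonneg_iff_ae.1 (hglb.1 hd)
  have hJ0 : ∀ d ∈ D, 0 ≤ J d := fun d hd => integral_nonneg_of_ae <| by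
    filter_upwards [hpos d hd] with ω h
    exact mul_nonneg h (abs_nonneg _)
  have hJmono : ∀ d e : OrliczSpace φ μ, d ≤ e → J d ≤ J e := fun d e hde =>
    integral_mono_ae (hint' d) (hint' e) <| by
      filter_upwards [le_iff_ae.1 hde] with ω h
      exact mul_le_mul_of_nonneg_right h (abs_nonneg _)
  set m := sInf (J '' D)
  have hbdd : BddBelow (J '' D) := ⟨0, by rintro _ ⟨d, hd, rfl⟩; exact hJ0 d hd⟩
  have hm : ∀ d ∈ D, m ≤ J d := fun d hd => csInf_le hbdd ⟨d, hd, rfl⟩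
  have hexists : ∀ n : ℕ, ∃ e : D, J e < m + 1 / ((n : ℝ) + 1) := by
    intro n
    obtain ⟨_, ⟨d, hd, rfl⟩, hlt⟩ := exists_lt_of_csInf_lt (hD.image J)
      (show m < m + 1 / ((n : ℝ) + 1) from lt_add_of_pos_right _ (by positivity))
    exact ⟨⟨d, hd⟩, hlt⟩
  choose e he using hexists
  have hlower : ∀ a b : D, ∃ c : D, c.1 ≤ a.1 ∧ c.1 ≤ b.1 := fun a b => by
    obtain ⟨c, hc, h1, h2⟩ := hdir a.1 a.2 b.1 b.2
    exact ⟨⟨c, hc⟩, h1, h2⟩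
  choose low hlow1 hlow2 using hlower
  set d : ℕ → D := fun n => Nat.rec (e 0) (fun n x => low x (e (n + 1))) n
  have hdanti : Antitone fun n => (d n).1 := antitone_nat_of_succ_le fun n => hlow1 _ _
  have hde : ∀ n, (d n).1 ≤ (e n).1 := by
    rintro (_ | n)
    · exact le_rfl
    · exact hlow2 _ _
  have hdJ : ∀ n : ℕ, J (d n) < m + 1 / ((n : ℝ) + 1) := fun n =>
    (hJmono _ _ (hde n)).trans_lt (he n)
  have hdpos : ∀ᵐ ω ∂μ, ∀ n, 0 ≤ (d n).1.1 ω := ae_all_iff.2 fun n => hpos _ (d n).2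
  have hdanti' : ∀ᵐ ω ∂μ, Antitone fun n => (d n).1.1 ω := by
    filter_upwards [ae_all_iff.2 fun n : ℕ => le_iff_ae.1 (hdanti n.le_succ)] with ω h
    exact antitone_nat_of_succ_le h
  set p : Ω → ℝ := fun ω => ⨅ n, (d n).1.1 ω
  have hpm : Measurable p := Measurable.iInf fun n => (d n).1.1.measurable
  have hp : ∀ᵐ ω ∂μ, 0 ≤ p ω ∧ ∀ n, p ω ≤ (d n).1.1 ω := by
    filter_upwards [hdpos] with ω h
    exact ⟨le_ciInf h, fun n => ciInf_le ⟨0, by rintro _ ⟨n, rfl⟩; exact h n⟩ n⟩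
  have hpd : ∀ b ∈ D, ∀ᵐ ω ∂μ, w ω ≠ 0 → p ω ≤ b.1 ω := by
    intro b hb
    have hint2 : ∀ n, Integrable (fun ω => (d n).1.1 ω * |w ω| - ((d n).1 ⊓ b).1 ω * |w ω|) μ :=
      fun n => (hint' _).sub (hint' _)
    set r : Ω → ℝ := fun ω => max (p ω - b.1 ω) 0 * |w ω|
    have hr0 : ∀ ω, 0 ≤ r ω := fun ω => by positivity
    have hrle : ∀ n, ∀ᵐ ω ∂μ, r ω ≤ (d n).1.1 ω * |w ω| - ((d n).1 ⊓ b).1 ω * |w ω| := by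
      intro n
      filter_upwards [hp, coeFn_inf (d n).1 b] with ω h1 h2
      rw [h2, ← sub_mul]
      refine mul_le_mul_of_nonneg_right (max_le ?_ ?_) (abs_nonneg _)
      · have := h1.2 n
        have := inf_le_right (a := (d n).1.1 ω) (b := b.1 ω)
        linarith
      · exact sub_nonneg.2 inf_le_left
    have hrint : Integrable r μ := by
      refine (hint2 0).mono' ?_ ?_
      · exact (((hpm.sub b.1.measurable).max measurable_const).mul hw.abs).aestronglyMeasurable
      · filter_upwards [hrle 0] with ω h
        rwa [Real.norm_of_nonneg (hr0 ω)]
    have hrI : ∫ ω, r ω ∂μ = 0 := by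
      refine le_antisymm ?_ (integral_nonneg hr0)
      refine ge_of_tendsto' tendsto_one_div_add_atTop_nhds_zero_nat fun n : ℕ => ?_
      refine (integral_mono_ae hrint (hint2 n) (hrle n)).trans ?_
      rw [integral_sub (hint' _) (hint' _)]
      obtain ⟨c, hc, h1, h2⟩ := hdir (d n).1 (d n).2 b hb
      have h3 := hJmono c ((d n).1 ⊓ b) (le_inf h1 h2)
      have h4 := hm c hc
      have h5 := hdJ n
      simp only [hJ] at h3 h4 h5
      linarith
    filter_upwards [(integral_eq_zero_iff_of_nonneg hr0 hrint).1 hrI] with ω h hne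
    have h' : max (p ω - b.1 ω) 0 = 0 := (mul_eq_zero.1 h).resolve_right (abs_ne_zero.2 hne)
    have := le_max_left (p ω - b.1 ω) 0
    linarith
  have hqm : AEStronglyMeasurable ({ω | w ω ≠ 0}.indicator p) μ :=
    (hpm.indicator (hw (measurableSet_singleton 0).compl)).aestronglyMeasurable
  obtain ⟨q, hq⟩ := exists_of_abs_le hqm (d 0).1 (by
    filter_upwards [hp, hdpos] with ω h h0
    rw [abs_of_nonneg (h0 0)]
    by_cases hω : w ω = 0
    · simpa [hω] using h0 0
    · rw [indicator_of_mem (by exact hω), abs_of_nonneg h.1]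
      exact h.2 0)
  have hq0 : q ≤ 0 := hglb.2 fun b hb => le_iff_ae.2 <| by
    filter_upwards [hq, hpd b hb, hpos b hb] with ω h1 h2 h3
    rw [h1]
    by_cases hω : w ω = 0
    · simpa [hω] using h3
    · rw [indicator_of_mem (by exact hω)]
      exact h2 hω
  have hlim : ∀ᵐ ω ∂μ, Tendsto (fun n => (d n).1.1 ω * |w ω|) atTop (𝓝 0) := by
    filter_upwards [hq, le_iff_ae.1 hq0, hp, hdpos, hdanti', coeFn_zero (φ := φ) (μ := μ)]
      with ω h1 h2 h3 h4 h5 h6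
    by_cases hω : w ω = 0
    · simp [hω]
    · rw [h1, h6, indicator_of_mem (by exact hω)] at h2
      have hp0 : p ω = 0 := le_antisymm h2 h3.1
      have := (tendsto_atTop_ciInf h5 ⟨0, by rintro _ ⟨n, rfl⟩; exact h4 n⟩).mul_const |w ω|
      rwa [show (⨅ n, (d n).1.1 ω) = 0 from hp0, zero_mul] at this
  have hJlim : Tendsto (fun n => J (d n)) atTop (𝓝 0) := by
    have := tendsto_integral_of_dominated_convergence (fun ω => (d 0).1.1 ω * |w ω|)
      (fun n => (hint' (d n).1).aestronglyMeasurable) (hint' (d 0).1) (fun n => by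
        filter_upwards [hdpos, hdanti'] with ω h1 h2
        rw [Real.norm_of_nonneg (mul_nonneg (h1 n) (abs_nonneg _))]
        exact mul_le_mul_of_nonneg_right (h2 n.zero_le) (abs_nonneg _)) hlim
    simpa using this
  obtain ⟨n, hn⟩ := (hJlim.eventually_lt_const hε).exists
  exact ⟨(d n).1, (d n).2, hn⟩

end Integral

section OrderContDual

variable {Ω : Type} [MeasurableSpace Ω] {φ : OrliczFunction} {μ : Measure Ω}

lemma mem_orderContDual_of_eq_integral {w : Ω → ℝ} (hw : Measurable w)
    (hint : ∀ f : OrliczSpace φ μ, Integrable (fun ω => f.1 ω * w ω) μ)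
    {G : StrongDual ℝ (OrliczSpace φ μ)} (hG : ∀ f, G f = ∫ ω, f.1 ω * w ω ∂μ) :
    G ∈ orderContDual (OrliczSpace φ μ) := by
  rintro ι _ _ _ f ⟨D, hD, hdir, hglb, hfD⟩
  rw [Metric.tendsto_nhds]
  intro ε hε
  obtain ⟨d, hd, hlt⟩ := exists_integral_lt_of_isGLB hw hint hD hdir hglb hε
  filter_upwards [hfD d hd] with a ha
  rw [sub_zero, abs_le_iff_ae] at ha
  rw [dist_zero_right, hG]
  refine (norm_integral_le_integral_norm _).trans_lt (lt_of_le_of_lt ?_ hlt)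
  have hle : ∀ᵐ ω ∂μ, ‖(f a).1 ω * w ω‖ ≤ d.1 ω * |w ω| := by
    filter_upwards [ha] with ω h
    rw [norm_mul]
    exact mul_le_mul_of_nonneg_right h (abs_nonneg _)
  refine integral_mono_ae (hint _).norm ?_ hle
  exact (hint d).mono ((aestronglyMeasurable d).mul hw.abs.aestronglyMeasurable)
    (ae_of_all _ fun ω => by simp)

lemma comp_mem_orderContDual {G : StrongDual ℝ (OrliczSpace φ μ)}
    (hG : G ∈ orderContDual (OrliczSpace φ μ)) {M : OrliczSpace φ μ →L[ℝ] OrliczSpace φ μ}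
    (hM : ∀ x, |M x| ≤ |x|) : G.comp M ∈ orderContDual (OrliczSpace φ μ) :=
  fun ι _ _ _ f hf => hG ι (fun a => M (f a)) (hf.of_abs_le fun a => hM (f a))

end OrderContDual

end OrliczSpace

/-! ### Functionals on the Orlicz heart -/

namespace OrliczHeart

open OrliczSpace

section

variable {Ω : Type*} [MeasurableSpace Ω] {φ : OrliczFunction} {μ : Measure Ω}

lemma ext_ae {u v : OrliczHeart φ μ} (h : ∀ᵐ ω ∂μ, u.1.1 ω = v.1.1 ω) : u = v :=
  Subtype.ext (OrliczSpace.ext_ae h)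

lemma exists_norm_indicator_le {ε : ℝ} (hε : 0 < ε) : ∃ δ : ENNReal, 0 < δ ∧
    ∀ (A : Set Ω) (f : OrliczSpace φ μ), MeasurableSet A → μ A < δ →
      (∀ᵐ ω ∂μ, f.1 ω = A.indicator 1 ω) → ‖f‖ ≤ ε := by
  refine ⟨ENNReal.ofReal (φ (1 / ε) + 1)⁻¹, ?_, fun A f hA hμ hf =>
    norm_le_of_orliczIntegral_le_one hε ?_⟩
  · have := φ.nonneg (t := 1 / ε) (by positivity)
    exact ENNReal.ofReal_pos.2 (by positivity)
  have h0 := φ.nonneg (t := 1 / ε) (by positivity)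
  calc orliczIntegral φ μ f.1 ε = ∫⁻ ω, A.indicator (fun _ => ENNReal.ofReal (φ (1 / ε))) ω ∂μ := by
        refine lintegral_congr_ae ?_
        filter_upwards [hf] with ω h
        rw [h]
        by_cases hω : ω ∈ A
        · simp [hω]
        · simp [hω, φ.map_zero']
    _ = ENNReal.ofReal (φ (1 / ε)) * μ A := lintegral_indicator_const hA _
    _ ≤ ENNReal.ofReal (φ (1 / ε)) * ENNReal.ofReal (φ (1 / ε) + 1)⁻¹ := by gcongr
    _ ≤ 1 := by
        rw [← ENNReal.ofReal_mul h0, ← ENNReal.ofReal_one]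
        refine ENNReal.ofReal_le_ofReal ?_
        rw [mul_inv_le_iff₀ (by linarith)]
        linarith

variable [IsFiniteMeasure μ]

lemma exists_of_bounded {F : Ω → ℝ} (hF : AEStronglyMeasurable F μ) {C : ℝ}
    (hC : ∀ ω, |F ω| ≤ C) : ∃ u : OrliczHeart φ μ, ∀ᵐ ω ∂μ, u.1.1 ω = F ω := by
  have hlt : ∀ c : ℝ, 0 < c → ∫⁻ ω, ENNReal.ofReal (φ (|F ω| / c)) ∂μ < ⊤ := by
    intro c hc
    calc ∫⁻ ω, ENNReal.ofReal (φ (|F ω| / c)) ∂μ ≤ ∫⁻ _, ENNReal.ofReal (φ (C / c)) ∂μ := by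
          refine lintegral_mono fun ω => ENNReal.ofReal_le_ofReal (φ.mono (by positivity) ?_)
          have := hC ω
          gcongr
      _ < ⊤ := by
          rw [lintegral_const]
          exact ENNReal.mul_lt_top ENNReal.ofReal_lt_top (measure_lt_top _ _)
  obtain ⟨f, hf⟩ := exists_of_lintegral_lt_top (φ := φ) hF one_pos (hlt 1 one_pos).ne
  refine ⟨⟨f, fun c hc => lt_of_eq_of_lt (lintegral_congr_ae ?_) (hlt c hc)⟩, hf⟩
  filter_upwards [hf] with ω h
  rw [h]

variable (φ μ) in
lemma exists_norm_le_mul : ∃ K > 0, ∀ (f : OrliczSpace φ μ) (C : ℝ), 0 < C →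
    (∀ᵐ ω ∂μ, |f.1 ω| ≤ C) → ‖f‖ ≤ K * C := by
  set K : ℝ := max 1 (φ 1 * μ.real univ)
  have hK1 : 1 ≤ K := le_max_left _ _
  have hK0 : 0 < K := by linarith
  refine ⟨K, hK0, fun f C hC h => norm_le_of_orliczIntegral_le_one (by positivity) ?_⟩
  calc orliczIntegral φ μ f.1 (K * C) ≤ ∫⁻ _, ENNReal.ofReal (φ 1 / K) ∂μ := by
        refine lintegral_mono_ae ?_
        filter_upwards [h] with ω h1
        refine ENNReal.ofReal_le_ofReal (le_trans (φ.mono (by positivity) ?_)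
          (OrliczFunction.map_div_le zero_le_one hK1))
        rw [div_le_div_iff₀ (by positivity) hK0]
        nlinarith
    _ = ENNReal.ofReal (φ 1 * μ.real univ / K) := by
        rw [lintegral_const, ← ofReal_measureReal (measure_ne_top _ _),
          ← ENNReal.ofReal_mul (div_nonneg (φ.nonneg zero_le_one) hK0.le), div_mul_eq_mul_div]
    _ ≤ 1 := by
        rw [← ENNReal.ofReal_one]
        exact ENNReal.ofReal_le_ofReal ((div_le_one hK0).2 (le_max_right _ _))

/-- The set function `A ↦ g 1_A` of a functional `g` on the heart is a signed measure, absolutely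
continuous with respect to `μ`; its density represents `g` on indicators. -/
lemma exists_density (g : StrongDual ℝ (OrliczHeart φ μ)) : ∃ w : Ω → ℝ, Measurable w ∧
    Integrable w μ ∧ ∀ (A : Set Ω) (u : OrliczHeart φ μ), MeasurableSet A →
      (∀ᵐ ω ∂μ, u.1.1 ω = A.indicator 1 ω) → g u = ∫ ω in A, w ω ∂μ := by
  classical
  have hex : ∀ A : Set Ω, ∃ u : OrliczHeart φ μ, MeasurableSet A →
      ∀ᵐ ω ∂μ, u.1.1 ω = A.indicator 1 ω := by
    intro A
    by_cases hA : MeasurableSet A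
    · obtain ⟨u, hu⟩ := exists_of_bounded (φ := φ) (μ := μ) (F := A.indicator 1) (C := 1)
        (measurable_one.indicator hA).aestronglyMeasurable fun ω => by
          by_cases hω : ω ∈ A <;> simp [hω]
      exact ⟨u, fun _ => hu⟩
    · exact ⟨0, fun h => absurd h hA⟩
  choose χ hχ using hex
  have hχ_unique : ∀ (A : Set Ω) (u : OrliczHeart φ μ), MeasurableSet A →
      (∀ᵐ ω ∂μ, u.1.1 ω = A.indicator 1 ω) → u = χ A := by
    intro A u hA hu
    refine ext_ae ?_
    filter_upwards [hu, hχ A hA] with ω h1 h2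
    rw [h1, h2]
  have hnull : ∀ A, MeasurableSet A → μ A = 0 → χ A = 0 := by
    intro A hA h0
    refine ext_ae ?_
    filter_upwards [hχ A hA, measure_eq_zero_iff_ae_notMem.1 h0,
      OrliczSpace.coeFn_zero (φ := φ) (μ := μ)] with ω h1 h2 h3
    rw [h1, indicator_of_notMem h2]
    exact h3.symm
  have hsum : ∀ A : ℕ → Set Ω, (∀ i, MeasurableSet (A i)) →
      Pairwise (Function.onFun Disjoint A) → HasSum (fun i => χ (A i)) (χ (⋃ i, A i)) := by
    intro A hA hd
    have htail : Tendsto (fun s : Finset ℕ => ∑' i : {i // i ∉ s}, μ (A i)) atTop (𝓝 0) :=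
      ENNReal.tendsto_tsum_compl_atTop_zero (by
        rw [← measure_iUnion hd hA]
        exact measure_ne_top μ _)
    rw [HasSum, SummationFilter.unconditional_filter, Metric.tendsto_nhds]
    intro ε hε
    obtain ⟨δ, hδ, hδ'⟩ := exists_norm_indicator_le (φ := φ) (μ := μ) (half_pos hε)
    filter_upwards [htail.eventually_lt_const hδ] with s hs
    set B : Set Ω := ⋃ i : {i // i ∉ s}, A i
    have hB : MeasurableSet B := MeasurableSet.iUnion fun i => hA i
    have hsplit : χ (⋃ i, A i) - ∑ i ∈ s, χ (A i) = χ B := by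
      refine hχ_unique B _ hB ?_
      have hcoe : ((χ (⋃ i, A i) - ∑ i ∈ s, χ (A i) : OrliczHeart φ μ) : OrliczSpace φ μ).1
          = (χ (⋃ i, A i)).1.1 - ∑ i ∈ s, (χ (A i)).1.1 := by
        simp
      rw [hcoe]
      filter_upwards [AEEqFun.coeFn_sub (χ (⋃ i, A i)).1.1 (∑ i ∈ s, (χ (A i)).1.1),
        AEEqFun.coeFn_finsetSum (μ := μ) s (fun i => (χ (A i)).1.1),
        hχ _ (MeasurableSet.iUnion hA), ae_all_iff.2 fun i => hχ (A i) (hA i)] with ω h1 h2 h3 h4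
      rw [h1, Pi.sub_apply, h2, Finset.sum_apply, h3, Finset.sum_congr rfl fun i _ => h4 i]
      by_cases hω : ∃ i₀, ω ∈ A i₀
      · obtain ⟨i₀, hi₀⟩ := hω
        have hother : ∀ i, i ≠ i₀ → ω ∉ A i := fun i hi => Set.disjoint_right.1 (hd hi) hi₀
        rw [indicator_of_mem (mem_iUnion.2 ⟨i₀, hi₀⟩)]
        by_cases his : i₀ ∈ s
        · rw [Finset.sum_eq_single_of_mem i₀ his fun i _ hi => indicator_of_notMem (hother i hi) _,
            indicator_of_mem hi₀, indicator_of_notMem, sub_self]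
          rw [mem_iUnion]
          rintro ⟨⟨i, hi⟩, hωi⟩
          exact hother i (by rintro rfl; exact hi his) hωi
        · rw [Finset.sum_eq_zero fun i hi =>
            indicator_of_notMem (hother i (by rintro rfl; exact his hi)) _,
            indicator_of_mem (mem_iUnion.2 ⟨⟨i₀, his⟩, hi₀⟩), sub_zero]
      · push Not at hω
        rw [indicator_of_notMem (by simpa using hω),
          Finset.sum_eq_zero fun i _ => indicator_of_notMem (hω i) _, indicator_of_notMem, sub_self]
        rw [mem_iUnion]
        rintro ⟨i, hi⟩
        exact hω i hi
    rw [dist_comm, dist_eq_norm, hsplit]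
    exact (hδ' B (χ B).1 hB ((measure_iUnion_le _).trans_lt hs) (hχ B hB)).trans_lt
      (half_lt_self hε)
  set ν : SignedMeasure Ω :=
    { measureOf' := fun A => if MeasurableSet A then g (χ A) else 0
      empty' := by simp [hnull ∅ MeasurableSet.empty measure_empty]
      not_measurable' := fun A hA => if_neg hA
      m_iUnion' := fun A hA hd => by
        have h := g.hasSum (hsum A hA hd)
        simpa only [hA, MeasurableSet.iUnion hA, if_true] using h } with hν
  have hνA : ∀ A, MeasurableSet A → ν A = g (χ A) := fun A hA => if_pos hA
  have hac : ν ≪ᵥ μ.toENNRealVectorMeasure := by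
    refine VectorMeasure.AbsolutelyContinuous.mk fun A hA h0 => ?_
    rw [Measure.toENNRealVectorMeasure_apply_measurable hA] at h0
    rw [hνA A hA, hnull A hA h0, map_zero]
  have hdens := (SignedMeasure.absolutelyContinuous_iff_withDensityᵥ_rnDeriv_eq ν μ).1 hac
  refine ⟨ν.rnDeriv μ, SignedMeasure.measurable_rnDeriv ν μ, SignedMeasure.integrable_rnDeriv ν μ,
    fun A u hA hu => ?_⟩
  rw [hχ_unique A u hA hu, ← hνA A hA,
    ← withDensityᵥ_apply (SignedMeasure.integrable_rnDeriv ν μ) hA,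
    hdens]

end

end OrliczHeart

namespace OrliczHeart

open OrliczSpace

section

variable {Ω : Type*} [MeasurableSpace Ω] {φ : OrliczFunction} {μ : Measure Ω} [IsFiniteMeasure μ]

/-- A bounded measurable function is within `ε` of a simple function, obtained by rounding down
to multiples of `ε`. -/
lemma exists_simpleFunc_abs_sub_le {F : Ω → ℝ} (hF : Measurable F) {C : ℝ} (hC : ∀ ω, |F ω| ≤ C)
    {ε : ℝ} (hε : 0 < ε) : ∃ s : SimpleFunc Ω ℝ, ∀ ω, |F ω - s ω| ≤ ε := by
  have hm : Measurable fun ω => (⌊F ω / ε⌋ : ℤ) := (hF.div_const ε).floor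
  refine ⟨⟨fun ω => ε * (⌊F ω / ε⌋ : ℤ), fun x => ?_, ?_⟩, fun ω => ?_⟩
  · exact ((measurable_from_top (f := fun z : ℤ => ε * (z : ℝ))).comp hm)
      (measurableSet_singleton x)
  · refine ((Set.finite_Icc ⌊-C / ε⌋ ⌊C / ε⌋).image fun z : ℤ => ε * (z : ℝ)).subset ?_
    rintro _ ⟨ω, rfl⟩
    have := abs_le.1 (hC ω)
    exact ⟨_, ⟨Int.floor_le_floor (by gcongr; exact this.1),
      Int.floor_le_floor (by gcongr; exact this.2)⟩, rfl⟩
  · have h1 := Int.floor_le (F ω / ε)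
    have h2 := (Int.lt_floor_add_one (F ω / ε)).le
    rw [le_div_iff₀ hε] at h1
    rw [div_le_iff₀ hε] at h2
    simp only [SimpleFunc.coe_mk]
    rw [abs_le]
    constructor <;> linarith

/-- The density of a functional on the heart represents it on all bounded functions. -/
lemma apply_eq_integral_of_bounded {g : StrongDual ℝ (OrliczHeart φ μ)} {w : Ω → ℝ}
    (hw : Integrable w μ) (hgw : ∀ (A : Set Ω) (u : OrliczHeart φ μ), MeasurableSet A →
      (∀ᵐ ω ∂μ, u.1.1 ω = A.indicator 1 ω) → g u = ∫ ω in A, w ω ∂μ)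
    {F : Ω → ℝ} (hF : Measurable F) {C : ℝ} (hC : ∀ ω, |F ω| ≤ C) {u : OrliczHeart φ μ}
    (hu : ∀ᵐ ω ∂μ, u.1.1 ω = F ω) : g u = ∫ ω, F ω * w ω ∂μ := by
  have hFw : ∀ {F : Ω → ℝ} {C : ℝ}, Measurable F → (∀ ω, |F ω| ≤ C) →
      Integrable (fun ω => F ω * w ω) μ := fun hF hC =>
    hw.bdd_mul hF.aestronglyMeasurable (ae_of_all _ hC)
  have hsb : ∀ s : SimpleFunc Ω ℝ, ∃ C, ∀ ω, |s ω| ≤ C := fun s => s.exists_forall_norm_le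
  have hsimple : ∀ (s : SimpleFunc Ω ℝ) (v : OrliczHeart φ μ), (∀ᵐ ω ∂μ, v.1.1 ω = s ω) →
      g v = ∫ ω, s ω * w ω ∂μ := by
    intro s
    induction s using SimpleFunc.induction with
    | @const c A hA =>
      intro v hv
      obtain ⟨χ, hχ⟩ := exists_of_bounded (φ := φ) (μ := μ) (F := A.indicator 1) (C := 1)
        (measurable_one.indicator hA).aestronglyMeasurable fun ω => by
          by_cases hω : ω ∈ A <;> simp [hω]
      have : v = c • χ := by
        refine ext_ae ?_
        filter_upwards [hv, hχ, OrliczSpace.coeFn_smul c χ.1] with ω h1 h2 h3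
        rw [h1, Submodule.coe_smul, h3, h2]
        by_cases hω : ω ∈ A <;> simp [hω]
      rw [this, map_smul, hgw A χ hA hχ, smul_eq_mul, ← integral_const_mul, ← integral_indicator hA]
      refine integral_congr_ae (ae_of_all _ fun ω => ?_)
      by_cases hω : ω ∈ A <;> simp [hω]
    | @add s t hst ihs iht =>
      intro v hv
      obtain ⟨Cs, hCs⟩ := hsb s
      obtain ⟨Ct, hCt⟩ := hsb t
      obtain ⟨a, ha⟩ := exists_of_bounded (φ := φ) (μ := μ) s.measurable.aestronglyMeasurable hCs
      obtain ⟨b, hb⟩ := exists_of_bounded (φ := φ) (μ := μ) t.measurable.aestronglyMeasurable hCt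
      have : v = a + b := by
        refine ext_ae ?_
        filter_upwards [hv, ha, hb, OrliczSpace.coeFn_add a.1 b.1] with ω h1 h2 h3 h4
        rw [h1, Submodule.coe_add, h4, h2, h3]
        rfl
      rw [this, map_add, ihs a ha, iht b hb, ← integral_add (hFw s.measurable hCs)
        (hFw t.measurable hCt)]
      refine integral_congr_ae (ae_of_all _ fun ω => ?_)
      simp [add_mul]
  obtain ⟨K, hK, hKb⟩ := exists_norm_le_mul φ μ
  set I := ∫ ω, |w ω| ∂μ
  have hI : 0 ≤ I := integral_nonneg fun ω => abs_nonneg _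
  have key : ∀ ε : ℝ, 0 < ε → |g u - ∫ ω, F ω * w ω ∂μ| ≤ ε * (‖g‖ * K + I) := by
    intro ε hε
    obtain ⟨s, hs⟩ := exists_simpleFunc_abs_sub_le hF hC hε
    obtain ⟨Cs, hCs⟩ := hsb s
    obtain ⟨v, hv⟩ := exists_of_bounded (φ := φ) (μ := μ) s.measurable.aestronglyMeasurable hCs
    have h1 : |g u - g v| ≤ ‖g‖ * (K * ε) := by
      rw [← map_sub]
      refine (g.le_opNorm _).trans ?_
      gcongr
      refine hKb (u - v).1 ε hε ?_
      filter_upwards [hu, hv, OrliczSpace.coeFn_sub u.1 v.1] with ω h1 h2 h3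
      rw [Submodule.coe_sub, h3, h1, h2]
      exact hs ω
    have h2 : |∫ ω, s ω * w ω ∂μ - ∫ ω, F ω * w ω ∂μ| ≤ ε * I := by
      rw [← integral_sub (hFw s.measurable hCs) (hFw hF hC), ← integral_const_mul]
      refine (abs_integral_le_integral_abs).trans (integral_mono_ae
        ((hFw s.measurable hCs).sub (hFw hF hC)).abs (hw.abs.const_mul ε)
        (ae_of_all _ fun ω => ?_))
      change |s ω * w ω - F ω * w ω| ≤ ε * |w ω|
      rw [← sub_mul, abs_mul, abs_sub_comm]
      exact mul_le_mul_of_nonneg_right (hs ω) (abs_nonneg _)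
    rw [hsimple s v hv] at h1
    calc _ ≤ |g u - ∫ ω, s ω * w ω ∂μ| + |∫ ω, s ω * w ω ∂μ - ∫ ω, F ω * w ω ∂μ| :=
          abs_sub_le _ _ _
      _ ≤ ‖g‖ * (K * ε) + ε * I := add_le_add h1 h2
      _ = _ := by ring
  have hlim : Tendsto (fun ε : ℝ => ε * (‖g‖ * K + I)) (𝓝[>] 0) (𝓝 0) := by
    have : Tendsto (fun ε : ℝ => ε * (‖g‖ * K + I)) (𝓝 0) (𝓝 (0 * (‖g‖ * K + I))) :=
      tendsto_id.mul_const _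
    rw [zero_mul] at this
    exact this.mono_left nhdsWithin_le_nhds
  have := ge_of_tendsto hlim (eventually_mem_nhdsWithin.mono fun ε hε => key ε hε)
  exact sub_eq_zero.1 (abs_nonpos_iff.1 this)

/-- The Köthe duality estimate `∫ |f w| ≤ ‖g‖ ‖f‖` for the density `w` of `g`, obtained by testing
`g` on the bounded functions `sign w · (|f| ∧ n)`. -/
lemma lintegral_mul_density_le {g : StrongDual ℝ (OrliczHeart φ μ)} {w : Ω → ℝ}
    (hwm : Measurable w) (hw : Integrable w μ)
    (hgw : ∀ (A : Set Ω) (u : OrliczHeart φ μ), MeasurableSet A →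
      (∀ᵐ ω ∂μ, u.1.1 ω = A.indicator 1 ω) → g u = ∫ ω in A, w ω ∂μ) (f : OrliczSpace φ μ) :
    ∫⁻ ω, ENNReal.ofReal (|f.1 ω| * |w ω|) ∂μ ≤ ENNReal.ofReal (‖g‖ * ‖f‖) := by
  have hfm : Measurable fun ω => |f.1 ω| := f.1.measurable.abs
  set S : ℕ → Ω → ℝ := fun n ω => min |f.1 ω| n
  have hS0 : ∀ n ω, 0 ≤ S n ω := fun n ω => le_min (abs_nonneg _) n.cast_nonneg
  have hSm : ∀ n, Measurable (S n) := fun n => hfm.min measurable_const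
  have hbound : ∀ n, ∫⁻ ω, ENNReal.ofReal (S n ω * |w ω|) ∂μ ≤ ENNReal.ofReal (‖g‖ * ‖f‖) := by
    intro n
    set σ : Ω → ℝ := fun ω => if 0 ≤ w ω then 1 else -1
    have hσm : Measurable σ :=
      Measurable.ite (measurableSet_le measurable_const hwm) measurable_const measurable_const
    have hσ1 : ∀ ω, |σ ω| = 1 := fun ω => by by_cases h : 0 ≤ w ω <;> simp [σ, h]
    have hσw : ∀ ω, σ ω * w ω = |w ω| := fun ω => by
      by_cases h : 0 ≤ w ω
      · simp [σ, h, abs_of_nonneg h]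
      · simp [σ, h, abs_of_neg (not_le.1 h)]
    have hFb : ∀ ω, |σ ω * S n ω| ≤ n := fun ω => by
      rw [abs_mul, hσ1, one_mul, abs_of_nonneg (hS0 n ω)]
      exact min_le_right _ _
    obtain ⟨u, hu⟩ := exists_of_bounded (φ := φ) (μ := μ) (hσm.mul (hSm n)).aestronglyMeasurable hFb
    have hgu := apply_eq_integral_of_bounded hw hgw (hσm.mul (hSm n)) hFb hu
    have hnorm : ‖u‖ ≤ ‖f‖ := by
      refine HasSolidNorm.solid (x := u.1) (y := f) (abs_le_abs_iff_ae.2 ?_)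
      filter_upwards [hu] with ω h
      rw [h, Pi.mul_apply, abs_mul, hσ1, one_mul, abs_of_nonneg (hS0 n ω)]
      exact min_le_left _ _
    have heq : ∀ ω, (σ * S n) ω * w ω = S n ω * |w ω| := fun ω => by
      rw [← hσw, Pi.mul_apply]
      ring
    simp only [heq] at hgu
    have hi : Integrable (fun ω => S n ω * |w ω|) μ :=
      hw.abs.bdd_mul (c := n) (hSm n).aestronglyMeasurable (ae_of_all _ fun ω => by
        rw [Real.norm_of_nonneg (hS0 n ω)]
        exact min_le_right _ _)
    rw [← ofReal_integral_eq_lintegral_ofReal hi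
      (ae_of_all _ fun ω => mul_nonneg (hS0 n ω) (abs_nonneg _)), ← hgu]
    refine ENNReal.ofReal_le_ofReal ((le_abs_self _).trans ((g.le_opNorm u).trans ?_))
    gcongr
  refine le_of_tendsto' (lintegral_tendsto_of_tendsto_of_monotone
    (f := fun n ω => ENNReal.ofReal (S n ω * |w ω|))
    (fun n => ((hSm n).mul hwm.abs).ennreal_ofReal.aemeasurable)
    (ae_of_all _ fun ω i j hij => ENNReal.ofReal_le_ofReal ?_) (ae_of_all _ fun ω => ?_)) hbound
  · have : (i : ℝ) ≤ j := by exact_mod_cast hij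
    exact mul_le_mul_of_nonneg_right (min_le_min le_rfl this) (abs_nonneg _)
  · refine tendsto_const_nhds.congr' ?_
    obtain ⟨N, hN⟩ := exists_nat_ge |f.1 ω|
    filter_upwards [eventually_ge_atTop N] with n hn
    have : (N : ℝ) ≤ n := by exact_mod_cast hn
    simp only [S]
    rw [min_eq_left (hN.trans this)]

end

/-- Every functional on the heart agrees on bounded functions with an order continuous functional
on the Orlicz space. -/
lemma exists_orderContDual_eq {Ω : Type} [MeasurableSpace Ω] {φ : OrliczFunction} {μ : Measure Ω}
    [IsFiniteMeasure μ] (g : StrongDual ℝ (OrliczHeart φ μ)) :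
    ∃ G ∈ orderContDual (OrliczSpace φ μ), ∀ (u : OrliczHeart φ μ) (C : ℝ),
      ∀ F : Ω → ℝ, Measurable F → (∀ ω, |F ω| ≤ C) → (∀ᵐ ω ∂μ, u.1.1 ω = F ω) → g u = G u.1 := by
  obtain ⟨w, hwm, hw, hgw⟩ := exists_density g
  have hle := lintegral_mul_density_le hwm hw hgw
  have hnorm : ∀ (f : OrliczSpace φ μ) (ω : Ω),
      ENNReal.ofReal ‖f.1 ω * w ω‖ = ENNReal.ofReal (|f.1 ω| * |w ω|) := fun f ω => by
    rw [norm_mul]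
    rfl
  have hint : ∀ f : OrliczSpace φ μ, Integrable (fun ω => f.1 ω * w ω) μ := by
    intro f
    refine ⟨(aestronglyMeasurable f).mul hwm.aestronglyMeasurable, ?_⟩
    rw [hasFiniteIntegral_iff_norm]
    simp only [hnorm]
    exact (hle f).trans_lt ENNReal.ofReal_lt_top
  set G : StrongDual ℝ (OrliczSpace φ μ) := LinearMap.mkContinuous
    { toFun := fun f => ∫ ω, f.1 ω * w ω ∂μ
      map_add' := fun f h => by
        rw [← integral_add (hint f) (hint h)]
        refine integral_congr_ae ?_
        filter_upwards [OrliczSpace.coeFn_add f h] with ω h1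
        rw [h1, add_mul]
      map_smul' := fun c f => by
        rw [RingHom.id_apply, smul_eq_mul, ← integral_const_mul]
        refine integral_congr_ae ?_
        filter_upwards [OrliczSpace.coeFn_smul c f] with ω h1
        rw [h1, mul_assoc] } ‖g‖ (fun f => by
      refine (norm_integral_le_lintegral_norm _).trans ?_
      refine ENNReal.toReal_le_of_le_ofReal (by positivity) ?_
      simp only [hnorm]
      exact hle f)
  have hG : ∀ f, G f = ∫ ω, f.1 ω * w ω ∂μ := fun f => rfl
  refine ⟨G, mem_orderContDual_of_eq_integral hwm hint hG, fun u C F hF hC hu => ?_⟩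
  rw [hG, apply_eq_integral_of_bounded hw hgw hF hC hu]
  refine integral_congr_ae ?_
  filter_upwards [hu] with ω h
  rw [h]

end OrliczHeart

/-! ### Property `(dH)` and the weak disjoint order Banach–Saks properties -/

section

variable {Ω : Type} [MeasurableSpace Ω] {φ : OrliczFunction} {μ : Measure Ω}

open OrliczSpace

lemma DoBSP.sigmaDoBSP {X : Type*} [NormedAddCommGroup X] [Lattice X] [NormedSpace ℝ X]
    (h : DoBSP X) (I : Set (StrongDual ℝ X)) : SigmaDoBSP I :=
  fun f _ hb hd => h f hb hd

lemma SigmaDoBSP.mono {X : Type*} [NormedAddCommGroup X] [Lattice X] [NormedSpace ℝ X]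
    {I J : Set (StrongDual ℝ X)} (hIJ : I ⊆ J) (h : SigmaDoBSP I) : SigmaDoBSP J :=
  fun f hf => h f fun g hg => hf g (hIJ hg)

lemma AbsSigmaDoBSP.mono {X : Type*} [NormedAddCommGroup X] [Lattice X] [NormedSpace ℝ X]
    {I J : Set (StrongDual ℝ X)} (hIJ : I ⊆ J) (h : AbsSigmaDoBSP I) : AbsSigmaDoBSP J :=
  fun f hf => h f fun g hg => hf g (hIJ hg)

lemma SigmaDoBSP.absSigmaDoBSP {X : Type*} [NormedAddCommGroup X] [Lattice X] [NormedSpace ℝ X]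
    [HasSolidNorm X] {I : Set (StrongDual ℝ X)} (h : SigmaDoBSP I) : AbsSigmaDoBSP I :=
  fun f hf => h f hf.sigmaNull

lemma normBddSeq_of_weakly_null {E : Type*} [NormedAddCommGroup E] [NormedSpace ℝ E] {f : ℕ → E}
    (hf : ∀ g : StrongDual ℝ E, Tendsto (fun n => g (f n)) atTop (𝓝 0)) :
    ∃ M : ℝ, ∀ n, ‖f n‖ ≤ M := by
  obtain ⟨M, hM⟩ := banach_steinhaus (g := fun n => NormedSpace.inclusionInDoubleDual ℝ E (f n))
    fun g => by
      obtain ⟨C, hC⟩ := (hf g).norm.bddAbove_range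
      exact ⟨C, fun n => hC ⟨n, rfl⟩⟩
  refine ⟨M, fun n => ?_⟩
  rw [← (NormedSpace.inclusionInDoubleDualLi ℝ (E := E)).norm_map (f n)]
  exact hM n

/-- A weakly null disjoint sequence of the heart is `|σ|(L^φ, (L^φ)^*)`-null: a sequence `y`
dominated by it is its image under one multiplication operator `M`, so `g (y n) = (g ∘ M) (f n)`. -/
lemma OrliczHeart.absSigmaNull_coe {f : ℕ → OrliczHeart φ μ}
    (hf : ∀ g : StrongDual ℝ (OrliczHeart φ μ), Tendsto (fun n => g (f n)) atTop (𝓝 0))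
    (hd : DisjointSeq fun n => (f n : OrliczSpace φ μ)) :
    AbsSigmaNull (univ : Set (StrongDual ℝ (OrliczSpace φ μ)))
      fun n => (f n : OrliczSpace φ μ) := by
  intro g _
  refine tendsto_dualAbs_of_dominated fun y hy => ?_
  obtain ⟨M, hM, -⟩ := hd.exists_mask hy
  refine (hf ((g.comp M).comp (OrliczHeart φ μ).subtypeL)).congr fun n => ?_
  rw [← hM n]
  rfl

/-- Truncating a function of finite `φ`-integral at a high level leaves a remainder of small
`φ`-integral. -/
lemma OrliczSpace.exists_truncation (f : OrliczSpace φ μ) {c : ℝ} (hc : 0 < c)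
    (h : orliczIntegral φ μ f.1 c ≠ ⊤) {ε : ENNReal} (hε : 0 < ε) :
    ∃ C : ℕ, ∫⁻ ω in {ω | (C : ℝ) < |f.1 ω|}, ENNReal.ofReal (φ (|f.1 ω| / c)) ∂μ < ε := by
  have hm : ∀ C : ℕ, MeasurableSet {ω | (C : ℝ) < |f.1 ω|} := fun C =>
    measurableSet_lt measurable_const f.1.measurable.abs
  have hlim := tendsto_lintegral_of_dominated_convergence (μ := μ)
    (F := fun C : ℕ => {ω | (C : ℝ) < |f.1 ω|}.indicator
      fun ω => ENNReal.ofReal (φ (|f.1 ω| / c))) (f := fun _ => 0)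
    (fun ω => ENNReal.ofReal (φ (|f.1 ω| / c)))
    (fun C => (orlicz_measurable f.1 hc).indicator (hm C))
    (fun C => ae_of_all _ (indicator_le_self _ _)) h (ae_of_all _ fun ω => by
      refine tendsto_const_nhds.congr' ?_
      obtain ⟨N, hN⟩ := exists_nat_ge |f.1 ω|
      filter_upwards [eventually_ge_atTop N] with n hn
      have : (N : ℝ) ≤ n := by exact_mod_cast hn
      rw [indicator_of_notMem]
      exact not_lt.2 (hN.trans this))
  rw [lintegral_zero] at hlim
  obtain ⟨C, hC⟩ := (hlim.eventually_lt_const hε).exists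
  exact ⟨C, by rwa [lintegral_indicator (hm C)] at hC⟩

/-- A disjoint `σ_n`-null sequence splits into bounded truncations `u n`, which are weakly null in
the heart, and remainders with summable `φ`-integrals, whose Cesàro means are order bounded. -/
lemma OrliczFunction.PropertyDH.sigmaDoBSP (h : φ.PropertyDH) :
    SigmaDoBSP (orderContDual (OrliczSpace φ unitLebesgue)) := by
  rintro f hσ ⟨B, hB⟩ hd
  have hB0 : 0 ≤ B := (norm_nonneg _).trans (hB 0)
  have hc : 0 < B + 1 := by linarith
  have hle1 : ∀ n, orliczIntegral φ unitLebesgue (f n).1 (B + 1) ≤ 1 := fun n =>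
    orliczIntegral_le_one ((hB n).trans_lt (by linarith))
  choose C hC using fun n => exists_truncation (f n) hc
    (ne_top_of_le_ne_top ENNReal.one_ne_top (hle1 n))
    (ε := ENNReal.ofReal ((1 / 2) ^ n)) (ENNReal.ofReal_pos.2 (by positivity))
  set T : ℕ → Set ℝ := fun n => {ω | (C n : ℝ) < |(f n).1 ω|}
  have hT : ∀ n, MeasurableSet (T n) := fun n =>
    measurableSet_lt measurable_const (f n).1.measurable.abs
  set F : ℕ → ℝ → ℝ := fun n => (T n)ᶜ.indicator fun ω => (f n).1 ω
  have hFm : ∀ n, Measurable (F n) := fun n => (f n).1.measurable.indicator (hT n).compl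
  have hFb : ∀ n ω, |F n ω| ≤ C n := fun n ω => by
    by_cases hω : ω ∈ T n
    · simp [F, hω]
    · simp only [F]
      rw [indicator_of_mem (by exact hω)]
      exact not_lt.1 hω
  choose u hu using fun n => OrliczHeart.exists_of_bounded (φ := φ) (μ := unitLebesgue)
    (hFm n).aestronglyMeasurable (hFb n)
  have huf : ∀ n, |(u n).1| ≤ |f n| := fun n => abs_le_abs_iff_ae.2 <| by
    filter_upwards [hu n] with ω h1
    rw [h1]
    by_cases hω : ω ∈ T n
    · simp [F, hω]
    · simp only [F]
      rw [indicator_of_mem (by exact hω)]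
  have hv : ∀ n, ∀ᵐ ω ∂unitLebesgue,
      (f n - (u n).1).1 ω = (T n).indicator (fun ω => (f n).1 ω) ω := fun n => by
    filter_upwards [hu n, coeFn_sub (f n) (u n).1] with ω h1 h2
    rw [h2, h1]
    by_cases hω : ω ∈ T n <;> simp [F, hω]
  have hvf : ∀ n, |f n - (u n).1| ≤ |f n| := fun n => abs_le_abs_iff_ae.2 <| by
    filter_upwards [hv n] with ω h1
    rw [h1]
    by_cases hω : ω ∈ T n <;> simp [hω]
  obtain ⟨M, hM, hM'⟩ := hd.exists_mask huf
  have huw : ∀ g : StrongDual ℝ (OrliczHeart φ unitLebesgue),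
      Tendsto (fun n => g (u n)) atTop (𝓝 0) := by
    intro g
    obtain ⟨G, hG, hgG⟩ := OrliczHeart.exists_orderContDual_eq g
    refine (hσ _ (comp_mem_orderContDual hG hM')).congr fun n => ?_
    rw [hgG (u n) (C n) (F n) (hFm n) (hFb n) (hu n), ← hM n]
    rfl
  obtain ⟨k, hk, hbu⟩ := h u huw (hd.of_abs_le huf)
  have hbv : OrderBdd (range (cesaroSeq fun n => f (k n) - (u (k n)).1)) := by
    refine ((hd.of_abs_le hvf).comp hk).orderBdd_cesaroSeq hc ?_
    refine ne_top_of_le_ne_top (b := ∑' n : ℕ, ENNReal.ofReal ((1 / 2 : ℝ) ^ n))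
      summable_geometric_two.tsum_ofReal_ne_top (ENNReal.tsum_le_tsum fun n => ?_)
    calc orliczIntegral φ unitLebesgue (f (k n) - (u (k n)).1).1 (((n : ℝ) + 1) * (B + 1))
        ≤ orliczIntegral φ unitLebesgue (f (k n) - (u (k n)).1).1 (B + 1) :=
          orliczIntegral_mono le_rfl hc
            (le_mul_of_one_le_left hc.le (by linarith [n.cast_nonneg (α := ℝ)]))
      _ = ∫⁻ ω, (T (k n)).indicator
            (fun ω => ENNReal.ofReal (φ (|(f (k n)).1 ω| / (B + 1)))) ω ∂unitLebesgue := by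
          refine lintegral_congr_ae ?_
          filter_upwards [hv (k n)] with ω h1
          rw [h1]
          by_cases hω : ω ∈ T (k n)
          · simp [hω]
          · simp [hω, φ.map_zero']
      _ ≤ ENNReal.ofReal ((1 / 2) ^ k n) := by
          rw [lintegral_indicator (hT _)]
          exact (hC (k n)).le
      _ ≤ ENNReal.ofReal ((1 / 2) ^ n) := ENNReal.ofReal_le_ofReal
          (pow_le_pow_of_le_one (by norm_num) (by norm_num) (hk.id_le n))
  have hsplit : f ∘ k = (fun n => (u (k n)).1) + fun n => f (k n) - (u (k n)).1 := by
    funext n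
    simp
  refine ⟨k, hk, 0, (hd.comp hk).orderTendsto_cesaroSeq ?_⟩
  rw [hsplit]
  exact hbu.cesaroSeq_add hbv

lemma propertyDH_of_absSigmaDoBSP
    (h : AbsSigmaDoBSP (univ : Set (StrongDual ℝ (OrliczSpace φ unitLebesgue)))) :
    φ.PropertyDH := by
  intro f hf hd
  obtain ⟨k, hk, x, hx⟩ := h (fun n => f n) (OrliczHeart.absSigmaNull_coe hf hd)
    (normBddSeq_of_weakly_null (E := OrliczHeart φ unitLebesgue) hf) hd
  exact ⟨k, hk, hx.orderBdd_range⟩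

end

theorem theorem5p1 (φ ψ : OrliczFunction) (hψ : φ.IsConjugate ψ) :
    [DoBSP (OrliczSpace φ unitLebesgue),
      SigmaDoBSP (uoDual (OrliczSpace φ unitLebesgue)),
      AbsSigmaDoBSP (uoDual (OrliczSpace φ unitLebesgue)),
      ψ.DeltaTwo].TFAE ∧
    [SigmaDoBSP (Set.univ : Set (StrongDual ℝ (OrliczSpace φ unitLebesgue))),
      AbsSigmaDoBSP (Set.univ : Set (StrongDual ℝ (OrliczSpace φ unitLebesgue))),
      SigmaDoBSP (orderContDual (OrliczSpace φ unitLebesgue)),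
      AbsSigmaDoBSP (orderContDual (OrliczSpace φ unitLebesgue)),
      φ.PropertyDH].TFAE := by
  constructor
  · tfae_have 1 → 2 := fun h => h.sigmaDoBSP _
    tfae_have 2 → 3 := fun h => h.absSigmaDoBSP
    tfae_have 3 → 1 := fun h f hb hd => h f (OrliczSpace.absSigmaNull_uoDual hb hd) hb hd
    tfae_have 1 → 4 := OrliczSpace.deltaTwo_of_doBSP hψ
    tfae_have 4 → 1 := OrliczSpace.doBSP_of_deltaTwo hψ
    tfae_finish
  · tfae_have 3 → 1 := fun h => h.mono (subset_univ _)
    tfae_have 3 → 4 := fun h => h.absSigmaDoBSP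
    tfae_have 1 → 2 := fun h => h.absSigmaDoBSP
    tfae_have 4 → 2 := fun h => h.mono (subset_univ _)
    tfae_have 2 → 5 := propertyDH_of_absSigmaDoBSP
    tfae_have 5 → 3 := fun h => h.sigmaDoBSP
    tfae_finish
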